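/- All manifolds are real, Hausdorff, second countable, finite-dimensional and $C^\infty$, and all maps, forms, vector fields and multivector fields are $C^\infty$. Let $m\ge 1$, let $M$ be an $m$-dimensional manifold with a volume form (nowhere vanishing $m$-form) $\eta$, let $\kappa\colon\mathcal M\to M$ be a fibre bundle with $\dim\mathcal M=n+m$, and put $\omega=\kappa^*\eta$. Let $\Omega\in\Omega^{m+1}(\mathcal M)$ be a closed form, possibly degenerate; $(\mathcal M,\Omega,\omega)$ is called a (pre)multisymplectic system. For a $j$-multivector field $\mathbf X$ (a section of $\Lambda^j T\mathcal M$), $i(\mathbf X)$ denotes contraction, determined by linearity and $i(X_1\wedge\dots\wedge X_j)\alpha=i(X_1)\cdots i(X_j)\alpha$ (and equal to $0$ on forms of degree $<j$), and $L(\mathbf X)=d\,i(\mathbf X)-(-1)^j\,i(\mathbf X)\,d$. Let $\ker^m\Omega$ be the set of $m$-multivector fields $\mathbf X$ on $\mathcal M$ with $i(\mathbf X)\Omega=0$ (and similarly on open subsets of $\mathcal M$), and let $\ker^m_\omega\Omega$ be the set of those $\mathbf X\in\ker^m\Omega$ for which the function $i(\mathbf X)\omega$ vanishes at no point of $\mathcal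 M$. A *conserved quantity* is a form $\xi\in\Omega^{m-1}(\mathcal M)$ such that $L(\mathbf X)\xi=0$ for every $\mathbf X\in\ker^m_\omega\Omega$. A *symmetry* is a diffeomorphism $\Phi\colon\mathcal M\to\mathcal M$ such that $\Phi_*(\ker^m\Omega)\subset\ker^m\Omega$. An *infinitesimal symmetry* is a vector field $Y$ on $\mathcal M$ whose local flows are local symmetries: for every local flow $F_t$ of $Y$, defined on an open set $U$, one has $F_{t*}(\ker^m\Omega)\subset\ker^m\Omega$, where the kernels are taken over $U$ and over $F_t(U)$ respectively. **Proposition.** 1. If $\Phi$ is a symmetry and $\xi$ is a conserved quantity of $(\mathcal M,\Omega,\omega)$, then $\Phi^*\xi$ is also a conserved quantity. 2. If $Y$ is an infinitesimal symmetry and $\xi$ is a conserved quantity of $(\mathcal M,\Omega,\omega)$, then $L(Y)\xi$ is also a conserved quantity. -/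

import Mathlib

open scoped Manifold ContDiff

noncomputable section

namespace Multisymplectic

/-! ### Pointwise multilinear algebra -/

section Algebra

/-- The reindexing for which `α ∘ slotEquiv` reads off `α (v (j-1), …, v 0, w 0, …, w (l-1))`. -/
def slotEquiv {j l k : ℕ} (h : j + l = k) : Fin j ⊕ Fin l ≃ Fin k :=
  (Equiv.sumCongr Fin.revPerm (Equiv.refl (Fin l))).trans (finSumFinEquiv.trans (finCongr h))

theorem slot_update_inr {W : Type*} {j l k : ℕ} (h : j + l = k) [DecidableEq (Fin l)]
    (v : Fin j → W) (w : Fin l → W) (i : Fin l) (z : W) :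
    (fun a => Sum.elim v (Function.update w i z) ((slotEquiv h).symm a)) =
      Function.update (fun a => Sum.elim v w ((slotEquiv h).symm a))
        (slotEquiv h (Sum.inr i)) z := by
  classical
  rw [← Sum.update_elim_inr]
  exact Function.update_comp_equiv (Sum.elim v w) (slotEquiv h).symm (Sum.inr i) z

theorem slot_update_inl {W : Type*} {j l k : ℕ} (h : j + l = k) [DecidableEq (Fin j)]
    (v : Fin j → W) (w : Fin l → W) (i : Fin j) (z : W) :
    (fun a => Sum.elim (Function.update v i z) w ((slotEquiv h).symm a)) =
      Function.update (fun a => Sum.elim v w ((slotEquiv h).symm a))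
        (slotEquiv h (Sum.inl i)) z := by
  classical
  rw [← Sum.update_elim_inl]
  exact Function.update_comp_equiv (Sum.elim v w) (slotEquiv h).symm (Sum.inl i) z

variable {V : Type*} [AddCommGroup V] [Module ℝ V] [TopologicalSpace V]

/-- `i(v₀) i(v₁) ⋯ i(v_{j-1}) α` for vectors `v₀, …, v_{j-1}`; as a form in the remaining slots `w`
it is `α (v_{j-1}, …, v₀, w₀, …, w_{l-1})`. -/
def contractVectors {j l k : ℕ} (h : j + l = k) (α : V [⋀^Fin k]→L[ℝ] ℝ) (v : Fin j → V) :
    V [⋀^Fin l]→L[ℝ] ℝ where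
  toFun w := α (fun i => Sum.elim v w ((slotEquiv h).symm i))
  map_update_add' w i x y := by
    have key (z : V) := slot_update_inr h v w i z
    simp only [key]
    exact α.map_update_add _ _ x y
  map_update_smul' w i c x := by
    have key (z : V) := slot_update_inr h v w i z
    simp only [key]
    exact α.map_update_smul _ _ c x
  map_eq_zero_of_eq' w a b hab hne :=
    α.map_eq_zero_of_eq _ (i := slotEquiv h (Sum.inr a)) (j := slotEquiv h (Sum.inr b))
      (by simpa using hab) (by simpa using hne)
  cont := by
    refine α.cont.comp (continuous_pi fun i => ?_)
    cases (slotEquiv h).symm i with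
    | inl a => simpa using continuous_const
    | inr a => simpa using continuous_apply a

/-- `contractVectors` as an alternating map of the contracted vectors. -/
def contractAlternating {j l k : ℕ} (h : j + l = k) (α : V [⋀^Fin k]→L[ℝ] ℝ) :
    V [⋀^Fin j]→ₗ[ℝ] (V [⋀^Fin l]→L[ℝ] ℝ) where
  toFun v := contractVectors h α v
  map_update_add' v i x y := by
    ext w
    have key (z : V) := slot_update_inl h v w i z
    change α _ = α _ + α _
    rw [key, key, key]
    exact α.map_update_add _ _ x y
  map_update_smul' v i c x := by
    ext w
    have key (z : V) := slot_update_inl h v w i z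
    change α _ = c • α _
    rw [key, key]
    exact α.map_update_smul _ _ c x
  map_eq_zero_of_eq' v a b hab hne := by
    ext w
    exact α.map_eq_zero_of_eq _ (i := slotEquiv h (Sum.inl a)) (j := slotEquiv h (Sum.inl b))
      (by simpa using hab) (by simpa using hne)

/-- The contraction `i(X) α` of a `j`-vector with a `k`-form, `k = j + l`: the linear extension of
`i(v₁ ∧ ⋯ ∧ v_j) α = i(v₁) ⋯ i(v_j) α`. -/
def contract {j l k : ℕ} (h : j + l = k) (X : ⋀[ℝ]^j V) (α : V [⋀^Fin k]→L[ℝ] ℝ) :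
    V [⋀^Fin l]→L[ℝ] ℝ :=
  exteriorPower.alternatingMapLinearEquiv (contractAlternating h α) X

end Algebra

/-! ### Forms and multivector fields on manifolds -/

section Manifold

variable {E : Type*} [NormedAddCommGroup E] [NormedSpace ℝ E]
  {N : Type*} [TopologicalSpace N] [ChartedSpace E N]
  {E' : Type*} [NormedAddCommGroup E'] [NormedSpace ℝ E']
  {N' : Type*} [TopologicalSpace N'] [ChartedSpace E' N']

/-- Fields of alternating `k`-forms on the manifold `N` (no regularity). -/
abbrev FormField (E : Type*) [NormedAddCommGroup E] [NormedSpace ℝ E]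
    (N : Type*) [TopologicalSpace N] [ChartedSpace E N] (k : ℕ) : Type _ :=
  (p : N) → TangentSpace 𝓘(ℝ, E) p [⋀^Fin k]→L[ℝ] ℝ

/-- Fields of `j`-vectors on the manifold `N`, i.e. sections of `Λ^j TN` (no regularity). -/
abbrev MultivectorField (E : Type*) [NormedAddCommGroup E] [NormedSpace ℝ E]
    (N : Type*) [TopologicalSpace N] [ChartedSpace E N] (j : ℕ) : Type _ :=
  (p : N) → ⋀[ℝ]^j (TangentSpace 𝓘(ℝ, E) p)

/-- The local expression of a form in the chart at `p₀`: the pullback by the inverse chart. -/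
def FormField.inChart {k : ℕ} (α : FormField E N k) (p₀ : N) (y : E) : E [⋀^Fin k]→L[ℝ] ℝ :=
  (α ((extChartAt 𝓘(ℝ, E) p₀).symm y)).compContinuousLinearMap
    (mfderiv 𝓘(ℝ, E) 𝓘(ℝ, E) (extChartAt 𝓘(ℝ, E) p₀).symm y)

/-- The local expression of a multivector field in the chart at `p₀`: its image under the tangent
map of the chart. -/
def MultivectorField.inChart {j : ℕ} (X : MultivectorField E N j) (p₀ : N) (y : E) : ⋀[ℝ]^j E :=
  exteriorPower.map j
    (mfderiv 𝓘(ℝ, E) 𝓘(ℝ, E) (extChartAt 𝓘(ℝ, E) p₀)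
      ((extChartAt 𝓘(ℝ, E) p₀).symm y)).toLinearMap
    (X ((extChartAt 𝓘(ℝ, E) p₀).symm y))

/-- Smooth differential forms: smooth local expression in every chart. -/
def FormField.IsSmooth {k : ℕ} (α : FormField E N k) : Prop :=
  ∀ p₀ : N, ContDiffOn ℝ ∞ (α.inChart p₀) (extChartAt 𝓘(ℝ, E) p₀).target

/-- Smooth multivector fields on `U` : the components of the local expression in every chart (its
values under all linear functionals on `Λ^j E`) are smooth functions. -/
def MultivectorField.IsSmoothOn {j : ℕ} (X : MultivectorField E N j) (U : Set N) : Prop :=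
  ∀ p₀ : N, ∀ ℓ : Module.Dual ℝ (⋀[ℝ]^j E),
    ContDiffOn ℝ ∞ (fun y => ℓ (X.inChart p₀ y))
      ((extChartAt 𝓘(ℝ, E) p₀).target ∩ (extChartAt 𝓘(ℝ, E) p₀).symm ⁻¹' U)

/-- The exterior derivative `dα`; at `p` it is computed in the chart at `p`. -/
def FormField.d {k : ℕ} (α : FormField E N k) : FormField E N (k + 1) := fun p =>
  (extDeriv (α.inChart p) (extChartAt 𝓘(ℝ, E) p p)).compContinuousLinearMap
    (mfderiv 𝓘(ℝ, E) 𝓘(ℝ, E) (extChartAt 𝓘(ℝ, E) p) p)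

/-- The pullback `f^*α`. -/
def FormField.pullback {k : ℕ} (f : N → N') (α : FormField E' N' k) : FormField E N k := fun p =>
  (α (f p)).compContinuousLinearMap (mfderiv 𝓘(ℝ, E) 𝓘(ℝ, E') f p)

/-- The contraction `i(X) α` of a `j`-vector field with a `k`-form, `k = j + l`. -/
def contraction {j l k : ℕ} (h : j + l = k) (X : MultivectorField E N j) (α : FormField E N k) :
    FormField E N l := fun p => contract h (X p) (α p)

/-- The Lie derivative `L(X) α = d i(X) α - (-1)^j i(X) d α` of a `k`-form `α` with respect to a
`j`-vector field `X`; it is an `l`-form with `l = k + 1 - j`. When `l = 0` we have `k < j`, and then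
`i(X) α = 0` by definition. -/
def lieDeriv {j k : ℕ} : {l : ℕ} → (h : j + l = k + 1) → MultivectorField E N j →
    FormField E N k → FormField E N l
  | 0, h, X, α => -((-1 : ℝ) ^ j • contraction h X α.d)
  | _ + 1, h, X, α =>
      (contraction (by omega) X α).d - (-1 : ℝ) ^ j • contraction h X α.d

/-- A vector field as a `1`-vector field. -/
def vectorToMultivector (Y : (p : N) → TangentSpace 𝓘(ℝ, E) p) : MultivectorField E N 1 :=
  fun p => exteriorPower.ιMulti ℝ 1 (fun _ => Y p)

/-- Smooth vector fields. -/
def IsSmoothVectorField [IsManifold 𝓘(ℝ, E) 1 N]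
    (Y : (p : N) → TangentSpace 𝓘(ℝ, E) p) : Prop :=
  ContMDiff 𝓘(ℝ, E) 𝓘(ℝ, E).tangent ∞ (fun p => (⟨p, Y p⟩ : TangentBundle 𝓘(ℝ, E) N))

/-- On `f '' U`, the field `X'` is the push-forward `f_* X` of the restriction of `X` to `U`. -/
def IsPushforwardOn {j : ℕ} (f : N → N) (U : Set N) (X X' : MultivectorField E N j) : Prop :=
  ∀ p ∈ U, X' (f p) = exteriorPower.map j (mfderiv 𝓘(ℝ, E) 𝓘(ℝ, E) f p).toLinearMap (X p)

/-- `F`, defined on `(-ε, ε) × U`, is a local flow of `Y` : every `t ↦ F t p` is the integral curve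
of `Y` through `p`. (For a smooth `Y` the smoothness of `F`, and that every `F t` is a
diffeomorphism of `U` onto an open set, are consequences.) -/
structure IsLocalFlow (Y : (p : N) → TangentSpace 𝓘(ℝ, E) p) (F : ℝ → N → N) (U : Set N)
    (ε : ℝ) : Prop where
  isOpen : IsOpen U
  map_zero : ∀ p ∈ U, F 0 p = p
  integralCurve : ∀ p ∈ U, IsMIntegralCurveOn (fun t => F t p) Y (Set.Ioo (-ε) ε)

/-- `κ : N → N'` is a smooth fibre bundle with typical fibre the manifold `Q`. -/
structure IsSmoothFiberBundle {F : Type*} [NormedAddCommGroup F] [NormedSpace ℝ F]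
    (Q : Type*) [TopologicalSpace Q] [ChartedSpace F Q]
    (κ : N → N') : Prop where
  contMDiff : ContMDiff 𝓘(ℝ, E) 𝓘(ℝ, E') ∞ κ
  surjective : Function.Surjective κ
  locallyTrivial : ∀ x : N', ∃ e : Bundle.Trivialization Q κ, x ∈ e.baseSet ∧
    ContMDiffOn 𝓘(ℝ, E) (𝓘(ℝ, E').prod 𝓘(ℝ, F)) ∞ e e.source ∧
    ContMDiffOn (𝓘(ℝ, E').prod 𝓘(ℝ, F)) 𝓘(ℝ, E) ∞ e.toOpenPartialHomeomorph.symm e.target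

end Manifold

/-! ### (Pre)multisymplectic systems -/

section Systems

variable {E : Type*} [NormedAddCommGroup E] [NormedSpace ℝ E]
  {N : Type*} [TopologicalSpace N] [ChartedSpace E N]
  {B : Type*} [NormedAddCommGroup B] [NormedSpace ℝ B]
  {M : Type*} [TopologicalSpace M] [ChartedSpace B M]

/-- `(N, Ω, ω)` with `ω = κ^*η` is a (pre)multisymplectic system: `κ : N → M` is a smooth fibre
bundle, `η` is a volume form on `M` and `Ω` is a closed `(m+1)`-form on `N`. It is multisymplectic
if `Ω` is moreover `1`-nondegenerate, and premultisymplectic otherwise. -/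
structure IsPremultisymplecticSystem {F : Type*} [NormedAddCommGroup F] [NormedSpace ℝ F]
    (Q : Type*) [TopologicalSpace Q] [ChartedSpace F Q] {m : ℕ}
    (κ : N → M) (η : FormField B M m) (Ω : FormField E N (m + 1)) : Prop where
  bundle : IsSmoothFiberBundle (E := E) (E' := B) (F := F) Q κ
  volume_smooth : η.IsSmooth
  volume_ne_zero : ∀ x, η x ≠ 0
  smooth : Ω.IsSmooth
  closed : Ω.d = 0

/-- `ker^m Ω` over `U`: the smooth `m`-vector fields `X` on `U` with `i(X) Ω = 0`. -/
def kerOn {m : ℕ} (Ω : FormField E N (m + 1)) (U : Set N) : Set (MultivectorField E N m) :=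
  {X | X.IsSmoothOn U ∧ ∀ p ∈ U, contraction rfl X Ω p = 0}

/-- `ker^m_ω Ω` for `ω = vol`: the smooth `m`-vector fields `X` on `N` with `i(X) Ω = 0` and
`i(X) ω ≠ 0` at every point. -/
def kerTransverse {m : ℕ} (Ω : FormField E N (m + 1)) (vol : FormField E N m) :
    Set (MultivectorField E N m) :=
  {X | X ∈ kerOn Ω Set.univ ∧ ∀ p, contraction (l := 0) rfl X vol p ≠ 0}

/-- Conserved quantities: smooth `(m-1)`-forms `ξ` with `L(X) ξ = 0` for every `X ∈ ker^m_ω Ω`,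
where `ω = vol`. -/
def IsConservedQuantity {m : ℕ} (hm : 1 ≤ m) (Ω : FormField E N (m + 1)) (vol : FormField E N m)
    (ξ : FormField E N (m - 1)) : Prop :=
  ξ.IsSmooth ∧ ∀ X ∈ kerTransverse Ω vol, lieDeriv (l := 0) (by omega) X ξ = 0

/-- `f_*(ker^m Ω) ⊆ ker^m Ω`, for `f` mapping `U` diffeomorphically onto `f '' U`. -/
def PreservesKer {m : ℕ} (Ω : FormField E N (m + 1)) (f : N → N) (U : Set N) : Prop :=
  ∀ X X' : MultivectorField E N m, X ∈ kerOn Ω U → IsPushforwardOn f U X X' →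
    X' ∈ kerOn Ω (f '' U)

/-- Symmetries: diffeomorphisms `Φ` with `Φ_*(ker^m Ω) ⊆ ker^m Ω`. -/
def IsSymmetry {m : ℕ} (Ω : FormField E N (m + 1))
    (Φ : Diffeomorph 𝓘(ℝ, E) 𝓘(ℝ, E) N N ∞) : Prop :=
  PreservesKer Ω Φ Set.univ

/-- Infinitesimal symmetries: smooth vector fields all of whose local flows `F` satisfy
`(F t)_*(ker^m Ω) ⊆ ker^m Ω` on the corresponding open sets. -/
def IsInfinitesimalSymmetry [IsManifold 𝓘(ℝ, E) 1 N] {m : ℕ} (Ω : FormField E N (m + 1))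
    (Y : (p : N) → TangentSpace 𝓘(ℝ, E) p) : Prop :=
  IsSmoothVectorField Y ∧ ∀ (F : ℝ → N → N) (U : Set N) (ε : ℝ), IsLocalFlow Y F U ε →
    ∀ t ∈ Set.Ioo (-ε) ε, PreservesKer Ω (F t) U

end Systems

end Multisymplectic

end

open scoped Manifold ContDiff

noncomputable section

namespace Multisymplectic

/-! ### Local flows in a normed space and their derivative in the initial point. -/

section Flow

open Set Metric Filter Topology
open scoped NNReal

variable {E : Type*} [NormedAddCommGroup E] [NormedSpace ℝ E]

/-! For an `m`-vector field `X` and an `(m-1)`-form `ξ`, the term `i(X)ξ` vanishes by degree, so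
`L(X)ξ = -(-1)^m i(X)dξ`. Hence `ξ` is conserved exactly when `dξ` is annihilated by every
transverse field of the kernel (`isConservedQuantity_iff`).

A symmetry preserves `ker^m Ω` but need not preserve transversality to the fibres. The gap is closed
by `contract_eq_zero_of_mem_kerOn`: if some `X₀` in the kernel is transverse and `Z` is any local
field in the kernel, then `X₀ + c g Z`, with `g` a bump function and `c > 0` small, is again
transverse. A form annihilated by `X₀` and by this sum is annihilated by `Z` at the centre of the
bump. If no transverse field exists, conservation is vacuous.

Part 1 follows from naturality, `i(X)Φ^*dξ = Φ^*(i(Φ_*X)dξ) = 0`, since `Φ_*X` lies in the kernel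
(`contract_pullback_eq_zero`).

For part 2, let `F_t` be a local flow of `Y` near `p`. The same argument gives `i(X_p)(F_t^*dξ)_p =
0` for all small `t ≥ 0`. At `t = 0` the derivative of `(F_t^*dξ)_p` is `d i(Y)dξ = d L(Y)ξ` at `p`,
by Cartan's formula for closed forms (`extDeriv_contract_apply`) and `d² = 0`; therefore `i(X)dL(Y)ξ
= 0`. This requires a local flow that is injective, has images that are neighbourhoods, and is
differentiable in the initial point with derivative solving the variational equation; it is built in
a chart (`exists_local_flow`, `exists_isLocalFlow`). -/

theorem norm_image_sub_sub_fderiv_le {V : E → E} (hV : Differentiable ℝ V) {K : ℝ≥0}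
    (hK : LipschitzWith K (fderiv ℝ V)) (x y : E) :
    ‖V y - V x - fderiv ℝ V x (y - x)‖ ≤ K * ‖y - x‖ ^ 2 := by
  have := (convex_closedBall x ‖y - x‖).norm_image_sub_le_of_norm_hasFDerivWithin_le'
    (f := V) (f' := fderiv ℝ V) (φ := fderiv ℝ V x) (C := K * ‖y - x‖) (x := x) (y := y)
    (fun z _ => (hV z).hasFDerivAt.hasFDerivWithinAt)
    (fun z hz => by
      have h1 := hK.dist_le_mul z x
      rw [dist_eq_norm] at h1
      exact h1.trans (by gcongr; exact hz))
    (mem_closedBall_self (norm_nonneg _)) (by simp [dist_eq_norm])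
  calc _ ≤ _ := this
    _ = _ := by ring

theorem gronwallBound_zero_eq_mul (K ε x : ℝ) :
    gronwallBound 0 K ε x = ε * gronwallBound 0 K 1 x := by
  unfold gronwallBound
  split_ifs <;> ring

/-- A compactly supported `C²` vector field has a flow for times in `[-1, 1]`. -/
theorem exists_flow_of_hasCompactSupport [CompleteSpace E] {V : E → E} {K C : ℝ≥0}
    (hK : LipschitzWith K V) (hC : ∀ x, ‖V x‖ ≤ C) (x₀ : E) (R : ℝ≥0) :
    ∃ φ : ℝ → E → E, ∃ L : ℝ≥0,
      (∀ x ∈ closedBall x₀ R, φ 0 x = x) ∧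
      (∀ x ∈ closedBall x₀ R, ∀ t ∈ Ioo (-1 : ℝ) 1,
        HasDerivAt (fun t => φ t x) (V (φ t x)) t) ∧
      (∀ t ∈ Ioo (-1 : ℝ) 1, LipschitzOnWith L (φ t) (closedBall x₀ R)) := by
  -- Initial points lie within `R` of `x₀` and move at most `C` in unit time, hence the radius `C +
  -- R`.
  have hpl : IsPicardLindelof (fun _ => V) (tmin := -1) (tmax := 1) ⟨0, by norm_num, by norm_num⟩
      x₀ (C + R) R C K :=
    IsPicardLindelof.of_time_independent (fun x _ => hC x) hK.lipschitzOnWith (by simp)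
  obtain ⟨α, hα, L, hL⟩ :=
    hpl.exists_forall_mem_closedBall_eq_hasDerivWithinAt_lipschitzOnWith
  exact ⟨fun t x => α x t, L, fun x hx => (hα x hx).1,
    fun x hx t ht => ((hα x hx).2 t (Ioo_subset_Icc_self ht)).hasDerivAt (Icc_mem_nhds ht.1 ht.2),
    fun t ht => hL t (Ioo_subset_Icc_self ht)⟩

/-- Solutions of the linear equation `A' = B A`, `A 0 = id`. -/
theorem exists_linear_ode_solution [CompleteSpace E] {B : ℝ → E →L[ℝ] E} {K : ℝ≥0}
    (hB : ContinuousOn B (Ico 0 1)) (hK : ∀ t ∈ Ico (0 : ℝ) 1, ‖B t‖ ≤ K) :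
    ∃ A : ℝ → E →L[ℝ] E, A 0 = ContinuousLinearMap.id ℝ E ∧ ∃ δ > 0, δ < 1 ∧
      ∀ t ∈ Icc (0 : ℝ) δ, HasDerivWithinAt A ((B t).comp (A t)) (Icc 0 δ) t := by
  -- On the unit ball around `id` one has `‖A‖ ≤ 2`, so the equation has speed at most `2 * K`; then
  -- `2 * K * δ ≤ 1` keeps the solution in that ball. The summand `2` covers `K = 0` and gives `δ <
  -- 1`.
  set δ : ℝ := 1 / (2 * K + 2) with hδ
  have hδ0 : 0 < δ := by positivity
  have hδ1 : δ < 1 := by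
    rw [hδ, div_lt_one (by positivity)]
    have := K.2
    change (0 : ℝ) ≤ K at this
    linarith
  have hsub : Icc 0 δ ⊆ Ico (0 : ℝ) 1 := fun t ht => ⟨ht.1, ht.2.trans_lt hδ1⟩
  have hpl : IsPicardLindelof (fun t (A : E →L[ℝ] E) => (B t).comp A) (tmin := 0) (tmax := δ)
      ⟨0, le_rfl, hδ0.le⟩ (ContinuousLinearMap.id ℝ E) 1 0 (2 * K) K := by
    refine ⟨fun t ht => ?_, fun A _ => ?_, fun t ht A hA => ?_, ?_⟩
    · refine LipschitzWith.lipschitzOnWith (LipschitzWith.of_dist_le_mul fun A A' => ?_)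
      rw [dist_eq_norm, dist_eq_norm, ← ContinuousLinearMap.comp_sub]
      exact (ContinuousLinearMap.opNorm_comp_le _ _).trans (by gcongr; exact hK t (hsub ht))
    · exact (hB.mono hsub).clm_comp continuousOn_const
    · have h1 : ‖A‖ ≤ 2 := by
        have h2 : ‖A - ContinuousLinearMap.id ℝ E‖ ≤ 1 := by
          simpa [dist_eq_norm] using hA
        have h3 := ContinuousLinearMap.norm_id_le (𝕜 := ℝ) (E := E)
        have h4 := norm_add_le (A - ContinuousLinearMap.id ℝ E) (ContinuousLinearMap.id ℝ E)
        rw [sub_add_cancel] at h4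
        linarith
      calc ‖(B t).comp A‖ ≤ ‖B t‖ * ‖A‖ := ContinuousLinearMap.opNorm_comp_le _ _
        _ ≤ K * 2 := by gcongr; exact hK t (hsub ht)
        _ = _ := by push_cast; ring
    · simp only [NNReal.coe_mul, NNReal.coe_ofNat, sub_zero, sub_self, NNReal.coe_one,
        NNReal.coe_zero]
      rw [max_eq_left hδ0.le, hδ, mul_one_div, div_le_one (by positivity)]
      linarith
  obtain ⟨A, hA0, hA⟩ := hpl.exists_eq_forall_mem_Icc_hasDerivWithinAt₀
  exact ⟨A, hA0, δ, hδ0, hδ1, hA⟩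

/-- The flow of a vector field is differentiable in the initial point, the derivative being the
solution of the variational equation. -/
theorem hasFDerivAt_flow {V : E → E} (hV : Differentiable ℝ V) {K K₂ L : ℝ≥0}
    (hK : LipschitzWith K V) (hK₂ : LipschitzWith K₂ (fderiv ℝ V)) {x₀ : E} {R : ℝ}
    (hR : 0 < R) {φ : ℝ → E → E} (h0 : ∀ x ∈ closedBall x₀ R, φ 0 x = x)
    (hφ : ∀ x ∈ closedBall x₀ R, ∀ t ∈ Ioo (-1 : ℝ) 1,
      HasDerivAt (fun t => φ t x) (V (φ t x)) t)
    (hL : ∀ t ∈ Ioo (-1 : ℝ) 1, LipschitzOnWith L (φ t) (closedBall x₀ R))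
    {A : ℝ → E →L[ℝ] E} (hA0 : A 0 = ContinuousLinearMap.id ℝ E) {δ : ℝ} (hδ : δ < 1)
    (hA : ∀ t ∈ Icc (0 : ℝ) δ,
      HasDerivWithinAt A ((fderiv ℝ V (φ t x₀)).comp (A t)) (Icc 0 δ) t)
    {t : ℝ} (ht : t ∈ Icc 0 δ) : HasFDerivAt (φ t) (A t) x₀ := by
  have hx₀ : x₀ ∈ closedBall x₀ R := mem_closedBall_self hR.le
  have hIoo : ∀ s ∈ Icc 0 δ, s ∈ Ioo (-1 : ℝ) 1 := fun s hs => ⟨by linarith [hs.1], by linarith [hs.2]⟩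
  -- The error `e(s) = φ s (x₀ + h) - φ s x₀ - A s h` starts at `0` and satisfies `‖e'‖ ≤ K ‖e‖ + K₂
  -- (L ‖h‖)²`, so Grönwall makes it quadratic in `h`.
  have key : ∀ h : E, ‖h‖ ≤ R →
      ‖φ t (x₀ + h) - φ t x₀ - A t h‖ ≤ K₂ * L ^ 2 * gronwallBound 0 K 1 t * ‖h‖ ^ 2 := by
    intro h hh
    have hx : x₀ + h ∈ closedBall x₀ R := by simpa [dist_eq_norm] using hh
    have hder : ∀ s ∈ Icc 0 δ, HasDerivWithinAt (fun s => φ s (x₀ + h) - φ s x₀ - A s h)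
        (V (φ s (x₀ + h)) - V (φ s x₀) - fderiv ℝ V (φ s x₀) (A s h)) (Icc 0 δ) s := by
      intro s hs
      have h1 := (hφ _ hx s (hIoo s hs)).hasDerivWithinAt (s := Icc 0 δ)
      have h2 := (hφ _ hx₀ s (hIoo s hs)).hasDerivWithinAt (s := Icc 0 δ)
      have h3 := (hA s hs).clm_apply (hasDerivWithinAt_const s (Icc 0 δ) h)
      simpa using (h1.fun_sub h2).fun_sub h3
    have hw : ∀ s ∈ Icc 0 δ, ‖φ s (x₀ + h) - φ s x₀‖ ≤ L * ‖h‖ := by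
      intro s hs
      simpa [dist_eq_norm] using (hL s (hIoo s hs)).dist_le_mul _ hx _ hx₀
    have hg := norm_le_gronwallBound_of_norm_deriv_right_le (a := 0) (b := t) (δ := 0) (K := K)
      (ε := K₂ * (L * ‖h‖) ^ 2)
      (f := fun s => φ s (x₀ + h) - φ s x₀ - A s h)
      (f' := fun s => V (φ s (x₀ + h)) - V (φ s x₀) - fderiv ℝ V (φ s x₀) (A s h))
      (fun s hs => ((hder s ⟨hs.1, hs.2.trans ht.2⟩).mono (Icc_subset_Icc_right ht.2)).continuousWithinAt)
      (fun s hs => by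
        refine (hder s ⟨hs.1, hs.2.le.trans ht.2⟩).mono_of_mem_nhdsWithin ?_
        exact mem_of_superset (Icc_mem_nhdsGE hs.2) (Icc_subset_Icc hs.1 ht.2))
      (by simp [hA0, h0 _ hx, h0 _ hx₀])
      (fun s hs => by
        have hs' : s ∈ Icc 0 δ := ⟨hs.1, hs.2.le.trans ht.2⟩
        have e : V (φ s (x₀ + h)) - V (φ s x₀) - fderiv ℝ V (φ s x₀) (A s h) =
            fderiv ℝ V (φ s x₀) (φ s (x₀ + h) - φ s x₀ - A s h) +
            (V (φ s (x₀ + h)) - V (φ s x₀) -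
              fderiv ℝ V (φ s x₀) (φ s (x₀ + h) - φ s x₀)) := by
          rw [map_sub _ (φ s (x₀ + h) - φ s x₀)]; abel
        rw [e]
        refine (norm_add_le _ _).trans (add_le_add ?_ ?_)
        · refine (ContinuousLinearMap.le_opNorm _ _).trans ?_
          gcongr
          exact norm_fderiv_le_of_lipschitz ℝ hK
        · refine (norm_image_sub_sub_fderiv_le hV hK₂ _ _).trans ?_
          gcongr
          exact hw s hs')
      t ⟨ht.1, le_rfl⟩
    rw [gronwallBound_zero_eq_mul, sub_zero] at hg
    refine hg.trans (le_of_eq ?_)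
    ring
  rw [hasFDerivAt_iff_isLittleO_nhds_zero]
  refine Asymptotics.IsBigO.trans_isLittleO (g := fun h : E => ‖h‖ ^ 2) ?_ ?_
  · refine Asymptotics.IsBigO.of_bound (K₂ * L ^ 2 * gronwallBound 0 K 1 t) ?_
    filter_upwards [closedBall_mem_nhds (0 : E) hR] with h hh
    simpa using key h (by simpa using hh)
  · exact Asymptotics.isLittleO_norm_pow_id one_lt_two

/-- Local flow of a vector field smooth near `x₀`. -/
theorem exists_local_flow [FiniteDimensional ℝ E] {V : E → E} {S : Set E} {x₀ : E}
    (hS : S ∈ 𝓝 x₀) (hV : ContDiffOn ℝ ∞ V S) :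
    ∃ (φ : ℝ → E → E) (A : ℝ → E →L[ℝ] E) (U : Set E) (ε : ℝ), 0 < ε ∧ IsOpen U ∧ x₀ ∈ U ∧
      U ⊆ S ∧ (∀ x ∈ U, φ 0 x = x) ∧
      (∀ x ∈ U, ∀ t ∈ Ioo (-ε) ε, φ t x ∈ S ∧ HasDerivAt (fun t => φ t x) (V (φ t x)) t) ∧
      (∀ t ∈ Ioo (-ε) ε, InjOn (φ t) U ∧ φ t '' U ∈ 𝓝 (φ t x₀)) ∧
      (∀ t ∈ Ico 0 ε, HasFDerivAt (φ t) (A t) x₀) ∧ A 0 = ContinuousLinearMap.id ℝ E ∧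
      HasDerivWithinAt A (fderiv ℝ V x₀) (Ici 0) 0 := by
  obtain ⟨r, hr, hrS⟩ := Metric.mem_nhds_iff.1 hS
  -- Cutting off makes `W` and its derivative globally Lipschitz, while `W = V` on the ball of
  -- radius `r / 2`.
  let f : ContDiffBump x₀ := ⟨r / 2, r * (3 / 4), by positivity, by linarith⟩
  set W : E → E := fun x => f x • V x with hWdef
  have hfs : tsupport f ⊆ ball x₀ r := by
    rw [f.tsupport_eq]
    exact closedBall_subset_ball (by change r * (3 / 4) < r; linarith)
  have hW : ContDiff ℝ 2 W := by
    rw [contDiff_iff_contDiffAt]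
    intro x
    by_cases hx : x ∈ tsupport f
    · have h1 : ContDiffAt ℝ 2 V x := by
        refine ((hV.mono hrS).contDiffAt (isOpen_ball.mem_nhds (hfs hx))).of_le ?_
        exact WithTop.coe_le_coe.2 (le_top : (2 : ℕ∞) ≤ ⊤)
      exact (f.contDiff.contDiffAt (n := 2)).smul h1
    · have : W =ᶠ[𝓝 x] fun _ => 0 := by
        filter_upwards [(isClosed_tsupport f).isOpen_compl.mem_nhds hx] with y hy
        simp [W, image_eq_zero_of_notMem_tsupport hy]
      exact contDiffAt_const.congr_of_eventuallyEq this
  have hWc : HasCompactSupport W := f.hasCompactSupport.smul_right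
  have hWV : ∀ x ∈ closedBall x₀ (r / 2), W x = V x := fun x hx => by
    simp [W, f.one_of_mem_closedBall hx]
  obtain ⟨K, hK⟩ := hW.lipschitzWith_of_hasCompactSupport hWc (by norm_num)
  obtain ⟨K₂, hK₂⟩ := ContDiff.lipschitzWith_of_hasCompactSupport (n := 1) (hWc.fderiv (𝕜 := ℝ))
    (hW.fderiv_right (by norm_num)) (by norm_num)
  obtain ⟨C, hC⟩ := hWc.exists_bound_of_continuous hW.continuous
  have hC0 : 0 ≤ C := (norm_nonneg _).trans (hC x₀)
  lift C to ℝ≥0 using hC0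
  set R : ℝ≥0 := ⟨r / 2, by positivity⟩ with hRdef
  have hR : (R : ℝ) = r / 2 := rfl
  obtain ⟨φ, L, h0, hφ, hL⟩ := exists_flow_of_hasCompactSupport hK hC x₀ R
  have hx₀ : x₀ ∈ closedBall x₀ (R : ℝ) := mem_closedBall_self R.2
  have hcont0 : ContinuousOn (fun t => φ t x₀) (Ioo (-1) 1) := fun t ht =>
    (hφ x₀ hx₀ t ht).continuousAt.continuousWithinAt
  obtain ⟨A, hA0, δ, hδ0, hδ1, hA⟩ := exists_linear_ode_solution
    (B := fun t => fderiv ℝ W (φ t x₀)) (K := K)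
    ((hW.continuous_fderiv (by norm_num)).comp_continuousOn
      (hcont0.mono fun t ht => ⟨by linarith [ht.1], ht.2⟩))
    (fun t _ => norm_fderiv_le_of_lipschitz ℝ hK)
  -- In time less than `ε` a point moves at most `C * ε ≤ r / 4`, so trajectories from the ball of
  -- radius `r / 4` stay where `W = V`. The `+ 1` avoids dividing by zero.
  set ε : ℝ := min δ (r / 4 / (C + 1)) with hε
  have hε0 : 0 < ε := lt_min hδ0 (by positivity)
  have hε1 : ε < 1 := (min_le_left _ _).trans_lt hδ1
  have hεC : C * ε ≤ r / 4 := by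
    have : ε ≤ r / 4 / (C + 1) := min_le_right _ _
    rw [le_div_iff₀ (by positivity)] at this
    nlinarith
  have hIoo : Ioo (-ε) ε ⊆ Ioo (-1 : ℝ) 1 := Ioo_subset_Ioo (by linarith) hε1.le
  have hmove : ∀ x ∈ closedBall x₀ (R : ℝ), ∀ t ∈ Ioo (-ε) ε, dist (φ t x) x < r / 4 ∨ φ t x = x := by
    intro x hx t ht
    have h1 := (convex_Ioo (-ε) ε).norm_image_sub_le_of_norm_hasDerivWithin_le (C := (C : ℝ))
      (f := fun t => φ t x) (f' := fun t => W (φ t x)) (x := 0) (y := t)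
      (fun s hs => (hφ x hx s (hIoo hs)).hasDerivWithinAt) (fun s _ => hC _)
      ⟨by linarith, hε0⟩ ht
    simp only [h0 x hx, sub_zero, Real.norm_eq_abs] at h1
    have h2 : |t| < ε := abs_lt.2 ht
    rcases eq_or_lt_of_le C.2 with hC' | hC'
    · right
      have hC'' : (C : ℝ) = 0 := hC'.symm
      rw [hC'', zero_mul] at h1
      exact sub_eq_zero.1 (norm_le_zero_iff.1 h1)
    · left
      rw [dist_eq_norm]
      have hC'' : (0 : ℝ) < C := hC'
      nlinarith
  have hmem : ∀ x ∈ ball x₀ (r / 4), ∀ t ∈ Ioo (-ε) ε, φ t x ∈ ball x₀ (R : ℝ) := by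
    intro x hx t ht
    have hx' : x ∈ closedBall x₀ (R : ℝ) := by
      rw [mem_closedBall]; rw [mem_ball] at hx; linarith
    rw [mem_ball, hR] at *
    rcases hmove x hx' t ht with h | h
    · linarith [dist_triangle (φ t x) x x₀]
    · rw [h]; linarith
  have hsub : ball x₀ (r / 4) ⊆ closedBall x₀ (R : ℝ) :=
    (ball_subset_ball (by rw [hR]; linarith)).trans ball_subset_closedBall
  -- two trajectories meeting once coincide
  have huniq : ∀ x ∈ closedBall x₀ (R : ℝ), ∀ y ∈ closedBall x₀ (R : ℝ), ∀ t ∈ Ioo (-ε) ε,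
      ∀ s ∈ Ioo (-ε) ε, ∀ u ∈ Ioo (-ε) ε, s + t ∈ Ioo (-ε) ε → u + t ∈ Ioo (-ε) ε →
        φ s y = φ (s + t) x → φ u y = φ (u + t) x := by
    intro x hx y hy t ht s hs u hu hst hut heq
    -- The times at which both `φ w y` and the shifted curve `φ (w + t) x` are controlled form an
    -- open interval; as `W` is autonomous, both curves solve the same equation there.
    have ha : ∀ w, w ∈ Ioo (max (-ε) (-ε - t)) (min ε (ε - t)) ↔
        w ∈ Ioo (-ε) ε ∧ w + t ∈ Ioo (-ε) ε := by
      intro w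
      simp only [mem_Ioo, max_lt_iff, lt_min_iff]
      constructor
      · rintro ⟨⟨a, b⟩, c, d⟩; exact ⟨⟨a, c⟩, by linarith, by linarith⟩
      · rintro ⟨⟨a, c⟩, b, d⟩; exact ⟨⟨a, by linarith⟩, c, by linarith⟩
    exact ODE_solution_unique_of_mem_Ioo (v := fun _ => W) (s := fun _ => univ) (K := K)
      (f := fun w => φ w y) (g := fun w => φ (w + t) x)
      (fun _ _ => hK.lipschitzOnWith) ((ha s).2 ⟨hs, hst⟩)
      (fun w hw => ⟨hφ y hy w (hIoo ((ha w).1 hw).1), trivial⟩)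
      (fun w hw => ⟨(hφ x hx (w + t) (hIoo ((ha w).1 hw).2)).comp_add_const w t, trivial⟩)
      heq ((ha u).2 ⟨hu, hut⟩)
  have hz : (0 : ℝ) ∈ Ioo (-ε) ε := ⟨by linarith, hε0⟩
  have hneg : ∀ t ∈ Ioo (-ε) ε, -t ∈ Ioo (-ε) ε := fun t ht => ⟨by linarith [ht.2], by linarith [ht.1]⟩
  have hback : ∀ x ∈ ball x₀ (r / 4), ∀ t ∈ Ioo (-ε) ε, φ (-t) (φ t x) = x := by
    intro x hx t ht
    have h1 := hmem x hx t ht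
    have := huniq x (hsub hx) (φ t x) (ball_subset_closedBall h1) t ht 0 hz (-t) (hneg t ht)
      (by simpa using ht) (by simpa using hz) (by rw [h0 _ (ball_subset_closedBall h1), zero_add])
    rw [this, neg_add_cancel, h0 _ (hsub hx)]
  refine ⟨φ, A, ball x₀ (r / 4), ε, hε0, isOpen_ball, mem_ball_self (by positivity), ?_,
    fun x hx => h0 x (hsub hx), ?_, ?_, ?_, hA0, ?_⟩
  · exact (ball_subset_ball (by linarith)).trans hrS
  · intro x hx t ht
    have h1 := hmem x hx t ht
    refine ⟨hrS (ball_subset_ball (by rw [hR]; linarith) h1), ?_⟩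
    rw [← hWV _ (ball_subset_closedBall h1)]
    exact hφ x (hsub hx) t (hIoo ht)
  · intro t ht
    refine ⟨fun x hx y hy hxy => ?_, ?_⟩
    · rw [← hback x hx t ht, ← hback y hy t ht]
      exact congrArg _ hxy
    · have hx₀' : x₀ ∈ ball x₀ (r / 4) := mem_ball_self (by positivity)
      -- Every `y` close to `φ t x₀` is flowed back by `φ (-t)` into the starting ball, and `y = φ t
      -- (φ (-t) y)`.
      have h1 : ball x₀ (R : ℝ) ∈ 𝓝 (φ t x₀) := isOpen_ball.mem_nhds (hmem x₀ hx₀' t ht)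
      have h2 : ContinuousAt (φ (-t)) (φ t x₀) :=
        (hL (-t) (hIoo (hneg t ht))).continuousOn.continuousAt
          (mem_of_superset h1 ball_subset_closedBall)
      have h3 : φ (-t) ⁻¹' ball x₀ (r / 4) ∈ 𝓝 (φ t x₀) := by
        refine h2.preimage_mem_nhds (isOpen_ball.mem_nhds ?_)
        rw [hback x₀ hx₀' t ht]
        exact hx₀'
      filter_upwards [h1, h3] with y hy hy'
      refine ⟨φ (-t) y, hy', ?_⟩
      have hy'' := ball_subset_closedBall hy
      have := huniq y hy'' (φ (-t) y) (hsub hy') (-t) (hneg t ht) 0 hz t ht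
        (by simpa using hneg t ht) (by simpa using hz) (by rw [h0 _ (hsub hy'), zero_add])
      rw [this, add_neg_cancel, h0 _ hy'']
  · intro t ht
    exact hasFDerivAt_flow (hW.differentiable (by norm_num)) hK hK₂ (by rw [hR]; positivity) h0 hφ
      hL hA0 hδ1 hA ⟨ht.1, ht.2.le.trans (min_le_left _ _)⟩
  · have h1 := hA 0 ⟨le_rfl, hδ0.le⟩
    have h2 : fderiv ℝ W x₀ = fderiv ℝ V x₀ := by
      refine Filter.EventuallyEq.fderiv_eq ?_
      filter_upwards [closedBall_mem_nhds x₀ (by positivity : 0 < r / 2)] with x hx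
      exact hWV x hx
    rw [h0 x₀ hx₀, hA0, ContinuousLinearMap.comp_id, h2] at h1
    exact h1.mono_of_mem_nhdsWithin (Icc_mem_nhdsGE hδ0)

end Flow

/-! ### Algebra of contractions. -/

section ContractAlgebra

/-- Decomposable multivectors span, which reduces identities linear in `X` to wedges of vectors. -/
theorem exteriorPower_induction {V : Type*} [AddCommGroup V] [Module ℝ V] {j : ℕ}
    {P : ⋀[ℝ]^j V → Prop}
    (ι : ∀ v : Fin j → V, P (exteriorPower.ιMulti ℝ j v))
    (add : ∀ X Y, P X → P Y → P (X + Y)) (smul : ∀ (c : ℝ) X, P X → P (c • X))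
    (X : ⋀[ℝ]^j V) : P X := by
  have hX : X ∈ Submodule.span ℝ (Set.range (exteriorPower.ιMulti ℝ j (M := V))) := by
    rw [exteriorPower.ιMulti_span]; trivial
  induction hX using Submodule.span_induction with
  | mem x hx => obtain ⟨v, rfl⟩ := hx; exact ι v
  | zero => simpa using smul 0 _ (ι 0)
  | add x y _ _ hx hy => exact add x y hx hy
  | smul c x _ hx => exact smul c x hx

theorem slotEquiv_one_symm {V : Type*} {k : ℕ} (h : 1 + k = k + 1) (v : V) (w : Fin k → V) :
    (fun i => Sum.elim (fun _ : Fin 1 => v) w ((slotEquiv h).symm i)) = Fin.cons v w := by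
  ext i
  obtain ⟨a, rfl⟩ := (slotEquiv h).surjective i
  rw [Equiv.symm_apply_apply]
  cases a with
  | inl a =>
    have : slotEquiv h (Sum.inl a) = 0 := by
      ext
      simp [slotEquiv]
    rw [this]; rfl
  | inr a =>
    have : slotEquiv h (Sum.inr a) = a.succ := by
      ext
      simp [slotEquiv]
    rw [this]; rfl

variable {V : Type*} [AddCommGroup V] [Module ℝ V] [TopologicalSpace V]
  {W : Type*} [AddCommGroup W] [Module ℝ W] [TopologicalSpace W]

variable {j l k : ℕ} (h : j + l = k)

theorem contract_ιMulti (v : Fin j → V) (α : V [⋀^Fin k]→L[ℝ] ℝ) :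
    contract h (exteriorPower.ιMulti ℝ j v) α = contractVectors h α v := by
  simp only [contract, exteriorPower.alternatingMapLinearEquiv_apply_ιMulti]
  rfl

theorem contract_add_left (X Y : ⋀[ℝ]^j V) (α : V [⋀^Fin k]→L[ℝ] ℝ) :
    contract h (X + Y) α = contract h X α + contract h Y α :=
  map_add _ X Y

theorem contract_smul_left (c : ℝ) (X : ⋀[ℝ]^j V) (α : V [⋀^Fin k]→L[ℝ] ℝ) :
    contract h (c • X) α = c • contract h X α :=
  map_smul _ c X

theorem contract_add_right (X : ⋀[ℝ]^j V) (α β : V [⋀^Fin k]→L[ℝ] ℝ) :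
    contract h X (α + β) = contract h X α + contract h X β := by
  induction X using exteriorPower_induction with
  | ι v => simp only [contract_ιMulti]; rfl
  | add X Y hX hY => simp only [contract_add_left, hX, hY]; abel
  | smul c X hX => simp only [contract_smul_left, hX, smul_add]

theorem contract_smul_right (c : ℝ) (X : ⋀[ℝ]^j V) (α : V [⋀^Fin k]→L[ℝ] ℝ) :
    contract h X (c • α) = c • contract h X α := by
  induction X using exteriorPower_induction with
  | ι v => simp only [contract_ιMulti]; rfl
  | add X Y hX hY => simp only [contract_add_left, hX, hY, smul_add]
  | smul d X hX => simp only [contract_smul_left, hX, smul_comm c d]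

/-- The contraction is natural. -/
theorem contract_compContinuousLinearMap (X : ⋀[ℝ]^j V) (α : W [⋀^Fin k]→L[ℝ] ℝ) (f : V →L[ℝ] W) :
    contract h X (α.compContinuousLinearMap f) =
      (contract h (exteriorPower.map j f.toLinearMap X) α).compContinuousLinearMap f := by
  induction X using exteriorPower_induction with
  | ι v =>
    rw [exteriorPower.map_apply_ιMulti, contract_ιMulti, contract_ιMulti]
    ext w
    change α _ = α _
    congr 1
    ext i
    change f (Sum.elim v w ((slotEquiv h).symm i)) =
      Sum.elim (f ∘ v) (fun i => f (w i)) ((slotEquiv h).symm i)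
    cases (slotEquiv h).symm i <;> rfl
  | add X Y hX hY => simp only [contract_add_left, hX, hY, map_add]; rfl
  | smul c X hX => simp only [contract_smul_left, hX, map_smul]; rfl

/-- Contraction with a single vector inserts it in the first slot. -/
theorem contract_ιMulti_one_apply {k : ℕ} (h : 1 + k = k + 1) (v : V)
    (α : V [⋀^Fin (k + 1)]→L[ℝ] ℝ) (w : Fin k → V) :
    contract h (exteriorPower.ιMulti ℝ 1 (fun _ => v)) α w = α (Fin.cons v w) := by
  rw [contract_ιMulti]
  change α _ = _
  rw [slotEquiv_one_symm]

end ContractAlgebra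

/-! ### Smoothness of form-valued maps in finite dimension. -/

section AlternatingCalculus

theorem contDiffOn_extDeriv {E : Type*} [NormedAddCommGroup E] [NormedSpace ℝ E] {k : ℕ} {α : E → E [⋀^Fin k]→L[ℝ] ℝ} {s : Set E} 
    (hs : IsOpen s)     (hα : ContDiffOn ℝ ∞ α s) : ContDiffOn ℝ ∞ (extDeriv α) s :=
  (ContinuousAlternatingMap.alternatizeUncurryFinCLM ℝ E ℝ).contDiff.comp_contDiffOn
    (hα.fderiv_of_isOpen hs (by simp))

variable {E : Type*} [NormedAddCommGroup E] [NormedSpace ℝ E]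
  {G : Type*} [NormedAddCommGroup G] [NormedSpace ℝ G]

/-- The coordinates of a form with respect to a basis. -/
def alternatingCoord {ι : Type*} (b : Module.Basis ι ℝ E) (k : ℕ) :
    (E [⋀^Fin k]→L[ℝ] ℝ) →ₗ[ℝ] ((Fin k → ι) → ℝ) where
  toFun α r := α (fun i => b (r i))
  map_add' _ _ := rfl
  map_smul' _ _ := rfl

theorem alternatingCoord_injective {ι : Type*} (b : Module.Basis ι ℝ E) (k : ℕ) :
    Function.Injective (alternatingCoord b k) := by
  intro α β hαβ
  apply ContinuousAlternatingMap.toAlternatingMap_injective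
  apply AlternatingMap.coe_multilinearMap_injective
  exact Module.Basis.ext_multilinear (fun _ => b) fun r => congrFun hαβ r

variable [FiniteDimensional ℝ E]

theorem finiteDimensional_alternating (k : ℕ) : FiniteDimensional ℝ (E [⋀^Fin k]→L[ℝ] ℝ) :=
  FiniteDimensional.of_injective _ (alternatingCoord_injective (Module.finBasis ℝ E) k)

/-- Evaluation on tuples of basis vectors embeds the forms linearly in a finite product; a linear
left inverse, continuous in finite dimension, recovers the form. -/
theorem contDiffWithinAt_alternating_of_apply {k : ℕ} {n : WithTop ℕ∞}
    {α : G → E [⋀^Fin k]→L[ℝ] ℝ} {s : Set G} {x : G}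
    (hα : ∀ v : Fin k → E, ContDiffWithinAt ℝ n (fun x => α x v) s x) :
    ContDiffWithinAt ℝ n α s x := by
  have := finiteDimensional_alternating (E := E) k
  set b := Module.finBasis ℝ E
  obtain ⟨g, hg⟩ := (alternatingCoord b k).exists_leftInverse_of_injective
    (LinearMap.ker_eq_bot.2 (alternatingCoord_injective b k))
  have e : α = fun x => LinearMap.toContinuousLinearMap g (alternatingCoord b k (α x)) := by
    ext1 x
    exact (LinearMap.congr_fun hg (α x)).symm
  rw [e]
  refine (LinearMap.toContinuousLinearMap g).contDiff.comp_contDiffWithinAt ?_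
  exact contDiffWithinAt_pi.2 fun r => hα _

theorem contDiffWithinAt_alternating_apply {k : ℕ} {n : WithTop ℕ∞}
    {α : G → E [⋀^Fin k]→L[ℝ] ℝ} {s : Set G} {x : G} (hα : ContDiffWithinAt ℝ n α s x)
    {w : Fin k → G → E} (hw : ∀ i, ContDiffWithinAt ℝ n (w i) s x) :
    ContDiffWithinAt ℝ n (fun x => α x (fun i => w i x)) s x := by
  set b := Module.finBasis ℝ E
  -- Expanding each vector in a basis leaves sums of products of scalar functions.
  have e : (fun x => α x (fun i => w i x)) = fun x =>
      ∑ r : Fin k → Fin (Module.finrank ℝ E), (∏ i, b.repr (w i x) (r i)) * α x fun i => b (r i) := by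
    ext x
    have h1 : (fun i => w i x) = fun i => ∑ j, b.repr (w i x) j • b j := by
      ext1 i; exact (b.sum_repr _).symm
    conv_lhs => rw [h1]
    rw [← ContinuousAlternatingMap.coe_toContinuousMultilinearMap,
      ContinuousMultilinearMap.map_sum]
    refine Finset.sum_congr rfl fun r _ => ?_
    rw [ContinuousMultilinearMap.map_smul_univ]
    rfl
  rw [e]
  refine ContDiffWithinAt.sum fun r _ => ContDiffWithinAt.mul ?_ ?_
  · refine contDiffWithinAt_prod fun i _ => ?_
    exact (LinearMap.toContinuousLinearMap (b.coord (r i))).contDiff.comp_contDiffWithinAt (hw i)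
  · exact (ContinuousAlternatingMap.apply ℝ E ℝ (fun i => b (r i))).contDiff.comp_contDiffWithinAt hα

theorem contDiffAt_compContinuousLinearMap {H : Type*} [NormedAddCommGroup H] [NormedSpace ℝ H]
    [FiniteDimensional ℝ H] {k : ℕ} {n : WithTop ℕ∞}
    {α : G → E [⋀^Fin k]→L[ℝ] ℝ} {f : G → H →L[ℝ] E} {x : G}
    (hα : ContDiffAt ℝ n α x) (hf : ContDiffAt ℝ n f x) :
    ContDiffAt ℝ n (fun x => (α x).compContinuousLinearMap (f x)) x :=
  contDiffWithinAt_alternating_of_apply fun _ =>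
    contDiffWithinAt_alternating_apply hα fun _ => hf.clm_apply contDiffAt_const

variable {j l k : ℕ} (h : j + l = k)

theorem contDiffOn_contract_const (X : ⋀[ℝ]^j E) {n : WithTop ℕ∞} {α : G → E [⋀^Fin k]→L[ℝ] ℝ}
    {s : Set G} (hα : ContDiffOn ℝ n α s) : ContDiffOn ℝ n (fun x => contract h X (α x)) s := by
  induction X using exteriorPower_induction with
  | ι v =>
    refine fun x hx => contDiffWithinAt_alternating_of_apply fun w => ?_
    simp only [contract_ιMulti]
    exact contDiffWithinAt_alternating_apply (hα x hx) fun _ => contDiffWithinAt_const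
  | add X Y hX hY => simp only [contract_add_left]; exact hX.add hY
  | smul c X hX => simp only [contract_smul_left]; exact hX.const_smul c

/-- Smoothness of `X` is given only through linear functionals, so `X` is expanded in a basis and
its coordinates serve as smooth coefficients. -/
theorem contDiffOn_contract {n : WithTop ℕ∞} {X : G → ⋀[ℝ]^j E} {α : G → E [⋀^Fin k]→L[ℝ] ℝ}
    {s : Set G} (hX : ∀ ℓ : Module.Dual ℝ (⋀[ℝ]^j E), ContDiffOn ℝ n (fun x => ℓ (X x)) s)
    (hα : ContDiffOn ℝ n α s) : ContDiffOn ℝ n (fun x => contract h (X x) (α x)) s := by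
  set b := Module.finBasis ℝ (⋀[ℝ]^j E)
  have e : (fun x => contract h (X x) (α x)) = fun x =>
      ∑ i, b.coord i (X x) • contract h (b i) (α x) := by
    ext1 x
    conv_lhs => rw [← b.sum_repr (X x)]
    change exteriorPower.alternatingMapLinearEquiv (contractAlternating h (α x)) _ = _
    rw [map_sum]
    refine Finset.sum_congr rfl fun i _ => ?_
    exact contract_smul_left h _ _ _
  rw [e]
  exact ContDiffOn.sum fun i _ => (hX _).smul (contDiffOn_contract_const h _ hα)

/-- Contraction with a fixed multivector commutes with differentiation in a parameter. -/
theorem hasDerivWithinAt_contract (X : ⋀[ℝ]^j E) {α : ℝ → E [⋀^Fin k]→L[ℝ] ℝ}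
    {α' : E [⋀^Fin k]→L[ℝ] ℝ} {s : Set ℝ} {t : ℝ} (hα : HasDerivWithinAt α α' s t) :
    HasDerivWithinAt (fun t => contract h X (α t)) (contract h X α') s t := by
  have := finiteDimensional_alternating (E := E) k
  let L : (E [⋀^Fin k]→L[ℝ] ℝ) →ₗ[ℝ] (E [⋀^Fin l]→L[ℝ] ℝ) :=
    { toFun := contract h X
      map_add' := contract_add_right h X
      map_smul' := fun c α => contract_smul_right h c X α }
  exact (LinearMap.toContinuousLinearMap L).hasFDerivAt.comp_hasDerivWithinAt t hα

end AlternatingCalculus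

/-! ### Forms, pullbacks, `d` and contractions in charts. -/

section LocalExpressions

open Filter Topology

variable {E : Type*} [NormedAddCommGroup E] [NormedSpace ℝ E]
  {N : Type*} [TopologicalSpace N] [ChartedSpace E N]
  {E' : Type*} [NormedAddCommGroup E'] [NormedSpace ℝ E']
  {N' : Type*} [TopologicalSpace N'] [ChartedSpace E' N']

/-- The tangent map of `f`, as a map between the model spaces. -/
def tangentD (E E' : Type*) [NormedAddCommGroup E] [NormedSpace ℝ E] [NormedAddCommGroup E']
    [NormedSpace ℝ E'] {N : Type*} [TopologicalSpace N] [ChartedSpace E N] {N' : Type*}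
    [TopologicalSpace N'] [ChartedSpace E' N'] (f : N → N') (x : N) : E →L[ℝ] E' := mfderiv 𝓘(ℝ, E) 𝓘(ℝ, E') f x

/-- The tangent map of the chart at `p`. -/
def chartD (E : Type*) [NormedAddCommGroup E] [NormedSpace ℝ E] {N : Type*} [TopologicalSpace N]
    [ChartedSpace E N] (p x : N) : E →L[ℝ] E := tangentD E E (extChartAt 𝓘(ℝ, E) p) x

/-- The tangent map of the inverse of the chart at `p`. -/
def chartSymmD (p : N) (y : E) : E →L[ℝ] E :=
  tangentD E E (extChartAt 𝓘(ℝ, E) p).symm y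

/-- The value of a form as a form on the model space. -/
def FormField.val {k : ℕ} (α : FormField E N k) (x : N) : E [⋀^Fin k]→L[ℝ] ℝ := α x

/-- The value of a multivector field as a multivector on the model space. -/
def MultivectorField.val {j : ℕ} (X : MultivectorField E N j) (x : N) : ⋀[ℝ]^j E := X x

theorem FormField.ext_val {k : ℕ} {α β : FormField E N k} (h : ∀ x, α.val x = β.val x) : α = β :=
  funext h

/-- Stating values on the model space `E` puts all points in one space, so that tangent maps compose
as endomorphisms of `E`. -/
theorem FormField.inChart_eq {k : ℕ} (α : FormField E N k) (p : N) (y : E) :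
    α.inChart p y = (α.val ((extChartAt 𝓘(ℝ, E) p).symm y)).compContinuousLinearMap
      (chartSymmD p y) := rfl

theorem MultivectorField.inChart_eq {j : ℕ} (X : MultivectorField E N j) (p : N) (y : E) :
    X.inChart p y = exteriorPower.map j
      (chartD E p ((extChartAt 𝓘(ℝ, E) p).symm y)).toLinearMap
      (X.val ((extChartAt 𝓘(ℝ, E) p).symm y)) := by
  unfold MultivectorField.inChart chartD tangentD MultivectorField.val
  rfl

theorem FormField.pullback_val {k : ℕ} (α : FormField E' N' k) (f : N → N') (x : N) :
    (α.pullback f : FormField E N k).val x =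
      (α.val (f x)).compContinuousLinearMap (tangentD E E' f x) := rfl

theorem FormField.d_val {k : ℕ} (α : FormField E N k) (x : N) :
    α.d.val x = (extDeriv (α.inChart x) (extChartAt 𝓘(ℝ, E) x x)).compContinuousLinearMap
      (chartD E x x) := rfl

theorem contraction_val {j l k : ℕ} (h : j + l = k) (X : MultivectorField E N j)
    (α : FormField E N k) (x : N) :
    (contraction h X α).val x = contract h (X.val x) (α.val x) := rfl

/-- The local expression of a map in the charts at `p` and `q`. -/
def mapInCharts (E E' : Type*) [NormedAddCommGroup E] [NormedSpace ℝ E] [NormedAddCommGroup E']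
    [NormedSpace ℝ E'] {N : Type*} [TopologicalSpace N] [ChartedSpace E N] {N' : Type*}
    [TopologicalSpace N'] [ChartedSpace E' N'] (f : N → N') (p : N) (q : N') : E → E' :=
  extChartAt 𝓘(ℝ, E') q ∘ f ∘ (extChartAt 𝓘(ℝ, E) p).symm

theorem FormField.pullback_id {k : ℕ} (α : FormField E N k) : α.pullback id = α := by
  refine FormField.ext_val fun x => ?_
  rw [FormField.pullback_val]
  have : tangentD E E (id : N → N) x = ContinuousLinearMap.id ℝ E := mfderiv_id
  rw [this]
  rfl

theorem FormField.IsSmooth.contDiffAt {k : ℕ} {α : FormField E N k} (hα : α.IsSmooth) {p : N}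
    {y : E} (hy : y ∈ (extChartAt 𝓘(ℝ, E) p).target) : ContDiffAt ℝ ∞ (α.inChart p) y :=
  (hα p).contDiffAt ((isOpen_extChartAt_target p).mem_nhds hy)

variable [IsManifold 𝓘(ℝ, E) ∞ N] [IsManifold 𝓘(ℝ, E') ∞ N']

theorem mdifferentiableAt_extChartAt_symm {p : N} {y : E} (hy : y ∈ (extChartAt 𝓘(ℝ, E) p).target) :
    MDifferentiableAt 𝓘(ℝ, E) 𝓘(ℝ, E) (extChartAt 𝓘(ℝ, E) p).symm y := by
  have := mdifferentiableWithinAt_extChartAt_symm hy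
  rwa [modelWithCornersSelf_coe, Set.range_id, mdifferentiableWithinAt_univ] at this

theorem mdifferentiableAt_extChartAt_of_mem {p x : N} (hx : x ∈ (extChartAt 𝓘(ℝ, E) p).source) :
    MDifferentiableAt 𝓘(ℝ, E) 𝓘(ℝ, E) (extChartAt 𝓘(ℝ, E) p) x :=
  mdifferentiableAt_extChartAt (by rwa [extChartAt_source] at hx)

theorem chartSymmD_comp_chartD {p : N} {y : E} (hy : y ∈ (extChartAt 𝓘(ℝ, E) p).target) :
    (chartSymmD p y).comp (chartD E p ((extChartAt 𝓘(ℝ, E) p).symm y)) =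
      ContinuousLinearMap.id ℝ E := by
  have := mfderivWithin_extChartAt_symm_comp_mfderiv_extChartAt hy
  rw [modelWithCornersSelf_coe, Set.range_id, mfderivWithin_univ] at this
  exact this

theorem chartSymmD_comp_chartD' {p x : N} (hx : x ∈ (extChartAt 𝓘(ℝ, E) p).source) :
    (chartSymmD p (extChartAt 𝓘(ℝ, E) p x)).comp (chartD E p x) = ContinuousLinearMap.id ℝ E := by
  have := chartSymmD_comp_chartD ((extChartAt 𝓘(ℝ, E) p).map_source hx)
  rwa [(extChartAt 𝓘(ℝ, E) p).left_inv hx] at this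

theorem hasFDerivAt_mapInCharts {f : N → N'} {p : N} {q : N'} {y : E}
    (hy : y ∈ (extChartAt 𝓘(ℝ, E) p).target)
    (hf : MDifferentiableAt 𝓘(ℝ, E) 𝓘(ℝ, E') f ((extChartAt 𝓘(ℝ, E) p).symm y))
    (hq : f ((extChartAt 𝓘(ℝ, E) p).symm y) ∈ (extChartAt 𝓘(ℝ, E') q).source) :
    HasFDerivAt (mapInCharts E E' f p q)
      ((chartD E' q (f ((extChartAt 𝓘(ℝ, E) p).symm y))).comp
        ((tangentD E E' f ((extChartAt 𝓘(ℝ, E) p).symm y)).comp (chartSymmD p y)) : E →L[ℝ] E') y :=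
  (((mdifferentiableAt_extChartAt_of_mem hq).hasMFDerivAt.comp y
    (hf.hasMFDerivAt.comp y (mdifferentiableAt_extChartAt_symm hy).hasMFDerivAt))).hasFDerivAt

theorem fderiv_mapInCharts {f : N → N'} {p : N} {q : N'} {y : E}
    (hy : y ∈ (extChartAt 𝓘(ℝ, E) p).target)
    (hf : MDifferentiableAt 𝓘(ℝ, E) 𝓘(ℝ, E') f ((extChartAt 𝓘(ℝ, E) p).symm y))
    (hq : f ((extChartAt 𝓘(ℝ, E) p).symm y) ∈ (extChartAt 𝓘(ℝ, E') q).source) :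
    fderiv ℝ (mapInCharts E E' f p q) y = (chartD E' q (f ((extChartAt 𝓘(ℝ, E) p).symm y))).comp
        ((tangentD E E' f ((extChartAt 𝓘(ℝ, E) p).symm y)).comp (chartSymmD p y)) :=
  (hasFDerivAt_mapInCharts hy hf hq).fderiv

/-- The tangent maps of the chart at `q` and of its inverse cancel, by the chain rule. -/
theorem FormField.inChart_pullback {k : ℕ} (α : FormField E' N' k) {f : N → N'} {p : N} {q : N'}
    {y : E} (hy : y ∈ (extChartAt 𝓘(ℝ, E) p).target)
    (hf : MDifferentiableAt 𝓘(ℝ, E) 𝓘(ℝ, E') f ((extChartAt 𝓘(ℝ, E) p).symm y))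
    (hq : f ((extChartAt 𝓘(ℝ, E) p).symm y) ∈ (extChartAt 𝓘(ℝ, E') q).source) :
    (α.pullback f : FormField E N k).inChart p y =
      (α.inChart q (mapInCharts E E' f p q y)).compContinuousLinearMap
        (fderiv ℝ (mapInCharts E E' f p q) y) := by
  have hx : (extChartAt 𝓘(ℝ, E') q).symm (mapInCharts E E' f p q y) =
      f ((extChartAt 𝓘(ℝ, E) p).symm y) := (extChartAt 𝓘(ℝ, E') q).left_inv hq
  have hid := chartSymmD_comp_chartD' hq
  rw [fderiv_mapInCharts hy hf hq, FormField.inChart_eq, FormField.inChart_eq,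
    FormField.pullback_val, hx]
  ext v
  simp only [ContinuousAlternatingMap.compContinuousLinearMap_apply]
  congr 1
  ext i
  exact (DFunLike.congr_fun hid _).symm

theorem contDiffAt_mapInCharts {f : N → N'} {p : N} {q : N'} {y : E}
    (hy : y ∈ (extChartAt 𝓘(ℝ, E) p).target)
    (hf : ContMDiffAt 𝓘(ℝ, E) 𝓘(ℝ, E') ∞ f ((extChartAt 𝓘(ℝ, E) p).symm y))
    (hq : f ((extChartAt 𝓘(ℝ, E) p).symm y) ∈ (extChartAt 𝓘(ℝ, E') q).source) :
    ContDiffAt ℝ ∞ (mapInCharts E E' f p q) y := by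
  have h1 : ContMDiffAt 𝓘(ℝ, E) 𝓘(ℝ, E) ∞ (extChartAt 𝓘(ℝ, E) p).symm y :=
    (contMDiffOn_extChartAt_symm p).contMDiffAt ((isOpen_extChartAt_target p).mem_nhds hy)
  have h2 : ContMDiffAt 𝓘(ℝ, E') 𝓘(ℝ, E') ∞ (extChartAt 𝓘(ℝ, E') q)
      (f ((extChartAt 𝓘(ℝ, E) p).symm y)) :=
    contMDiffAt_extChartAt' (by rwa [extChartAt_source] at hq)
  exact (h2.comp y (hf.comp y h1)).contDiffAt

/-- Near a point the local expression of `f^* α` is the pullback of a local expression of `α`. -/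
theorem FormField.inChart_pullback_eventuallyEq {k : ℕ} (α : FormField E' N' k) {f : N → N'}
    {p : N} {q : N'} {y : E} (hy : y ∈ (extChartAt 𝓘(ℝ, E) p).target)
    (hf : ContMDiff 𝓘(ℝ, E) 𝓘(ℝ, E') ∞ f)
    (hq : f ((extChartAt 𝓘(ℝ, E) p).symm y) ∈ (extChartAt 𝓘(ℝ, E') q).source) :
    (α.pullback f : FormField E N k).inChart p =ᶠ[𝓝 y] fun z =>
      (α.inChart q (mapInCharts E E' f p q z)).compContinuousLinearMap
        (fderiv ℝ (mapInCharts E E' f p q) z) := by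
  have h1 : ContinuousAt (extChartAt 𝓘(ℝ, E) p).symm y := continuousAt_extChartAt_symm'' hy
  have h2 := (hf.continuous.continuousAt.comp h1).preimage_mem_nhds
    ((isOpen_extChartAt_source q).mem_nhds hq)
  filter_upwards [(isOpen_extChartAt_target p).mem_nhds hy, h2] with z hz hz'
  exact α.inChart_pullback hz (hf.mdifferentiable (by simp) _) hz'

theorem two_le_infty : minSmoothness ℝ 2 ≤ (∞ : WithTop ℕ∞) := by
  rw [minSmoothness_of_isRCLikeNormedField]
  exact WithTop.coe_le_coe.2 le_top

theorem extDeriv_inChart_pullback {k : ℕ} {α : FormField E' N' k} (hα : α.IsSmooth) {f : N → N'}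
    {p : N} {q : N'} {y : E} (hy : y ∈ (extChartAt 𝓘(ℝ, E) p).target)
    (hf : ContMDiff 𝓘(ℝ, E) 𝓘(ℝ, E') ∞ f)
    (hq : f ((extChartAt 𝓘(ℝ, E) p).symm y) ∈ (extChartAt 𝓘(ℝ, E') q).source) :
    extDeriv ((α.pullback f : FormField E N k).inChart p) y =
      (extDeriv (α.inChart q) (mapInCharts E E' f p q y)).compContinuousLinearMap
        (fderiv ℝ (mapInCharts E E' f p q) y) := by
  rw [(α.inChart_pullback_eventuallyEq hy hf hq).extDeriv_eq]
  have hmem : mapInCharts E E' f p q y ∈ (extChartAt 𝓘(ℝ, E') q).target :=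
    (extChartAt 𝓘(ℝ, E') q).map_source hq
  exact extDeriv_pullback ((hα.contDiffAt hmem).differentiableAt (by simp))
    (contDiffAt_mapInCharts hy hf.contMDiffAt hq) two_le_infty

/-- The exterior derivative may be computed in any chart. -/
theorem FormField.d_inChart {k : ℕ} {α : FormField E N k} (hα : α.IsSmooth) {p : N} {y : E}
    (hy : y ∈ (extChartAt 𝓘(ℝ, E) p).target) :
    α.d.inChart p y = extDeriv (α.inChart p) y := by
  set x := (extChartAt 𝓘(ℝ, E) p).symm y with hx
  -- The value of `d` at `x` is defined in the chart at `x`; naturality for the identity map, read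
  -- in the charts at `p` and at `x`, is the change of chart.
  have h := extDeriv_inChart_pullback (q := x) hα hy (f := id) contMDiff_id
    (mem_extChartAt_source x)
  rw [FormField.pullback_id] at h
  rw [h, fderiv_mapInCharts hy mdifferentiableAt_id (mem_extChartAt_source x),
    FormField.inChart_eq, FormField.d_val]
  have : tangentD E E (id : N → N) x = ContinuousLinearMap.id ℝ E := mfderiv_id
  rw [← hx, this]
  rfl

theorem FormField.IsSmooth.d {k : ℕ} {α : FormField E N k} (hα : α.IsSmooth) : α.d.IsSmooth :=
  fun p => (contDiffOn_extDeriv (isOpen_extChartAt_target p) (hα p)).congr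
    fun _ hy => FormField.d_inChart hα hy

theorem FormField.extDeriv_d_inChart {k : ℕ} {α : FormField E N k} (hα : α.IsSmooth) {p : N}
    {y : E} (hy : y ∈ (extChartAt 𝓘(ℝ, E) p).target) : extDeriv (α.d.inChart p) y = 0 := by
  have : α.d.inChart p =ᶠ[𝓝 y] extDeriv (α.inChart p) := by
    filter_upwards [(isOpen_extChartAt_target p).mem_nhds hy] with z hz
    exact FormField.d_inChart hα hz
  rw [this.extDeriv_eq]
  exact extDeriv_extDeriv_apply (hα.contDiffAt hy) two_le_infty

/-- The exterior derivative commutes with pullbacks. -/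
theorem FormField.d_pullback {k : ℕ} {α : FormField E' N' k} (hα : α.IsSmooth) {f : N → N'}
    (hf : ContMDiff 𝓘(ℝ, E) 𝓘(ℝ, E') ∞ f) :
    (α.pullback f : FormField E N k).d = α.d.pullback f := by
  refine FormField.ext_val fun x => ?_
  have hx := mem_extChartAt_source (I := 𝓘(ℝ, E)) x
  have hy := mem_extChartAt_target (I := 𝓘(ℝ, E)) x
  have hxx : (extChartAt 𝓘(ℝ, E) x).symm (extChartAt 𝓘(ℝ, E) x x) = x :=
    (extChartAt 𝓘(ℝ, E) x).left_inv hx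
  have hq : f ((extChartAt 𝓘(ℝ, E) x).symm (extChartAt 𝓘(ℝ, E) x x)) ∈
      (extChartAt 𝓘(ℝ, E') (f x)).source := by
    rw [hxx]; exact mem_extChartAt_source (f x)
  rw [FormField.d_val, extDeriv_inChart_pullback hα hy hf hq,
    fderiv_mapInCharts hy (hf.mdifferentiable (by simp) _) hq, FormField.pullback_val,
    FormField.d_val]
  have hm : mapInCharts E E' f x (f x) (extChartAt 𝓘(ℝ, E) x x) =
      extChartAt 𝓘(ℝ, E') (f x) (f x) := by
    simp only [mapInCharts, Function.comp_apply, hxx]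
  have hid := chartSymmD_comp_chartD' hx
  rw [hm, hxx]
  ext v
  simp only [ContinuousAlternatingMap.compContinuousLinearMap_apply]
  congr 1
  ext i
  have := DFunLike.congr_fun hid (v i)
  simp only [ContinuousLinearMap.comp_apply, ContinuousLinearMap.id_apply] at this
  simp only [Function.comp_apply, ContinuousLinearMap.comp_apply, this]

theorem FormField.IsSmooth.pullback [FiniteDimensional ℝ E] [FiniteDimensional ℝ E'] {k : ℕ}
    {α : FormField E' N' k} (hα : α.IsSmooth) {f : N → N'}
    (hf : ContMDiff 𝓘(ℝ, E) 𝓘(ℝ, E') ∞ f) : (α.pullback f : FormField E N k).IsSmooth := by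
  intro p y hy
  apply ContDiffAt.contDiffWithinAt
  set q := f ((extChartAt 𝓘(ℝ, E) p).symm y)
  have hq := mem_extChartAt_source (I := 𝓘(ℝ, E')) q
  refine ContDiffAt.congr_of_eventuallyEq ?_ (α.inChart_pullback_eventuallyEq hy hf hq)
  have hmem : mapInCharts E E' f p q y ∈ (extChartAt 𝓘(ℝ, E') q).target :=
    (extChartAt 𝓘(ℝ, E') q).map_source hq
  have h1 := contDiffAt_mapInCharts hy hf.contMDiffAt hq
  exact contDiffAt_compContinuousLinearMap ((hα.contDiffAt hmem).comp y h1)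
    (h1.fderiv_right (by simp))

theorem contraction_inChart {j l k : ℕ} (h : j + l = k) (X : MultivectorField E N j)
    (α : FormField E N k) {p : N} {y : E} (hy : y ∈ (extChartAt 𝓘(ℝ, E) p).target) :
    (contraction h X α).inChart p y = contract h (X.inChart p y) (α.inChart p y) := by
  rw [FormField.inChart_eq, FormField.inChart_eq, MultivectorField.inChart_eq, contraction_val,
    contract_compContinuousLinearMap]
  congr 2
  have := chartSymmD_comp_chartD hy
  rw [← LinearMap.comp_apply, ← exteriorPower.map_comp]
  have e : (chartSymmD p y).toLinearMap ∘ₗ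
      (chartD E p ((extChartAt 𝓘(ℝ, E) p).symm y)).toLinearMap = LinearMap.id := by
    ext v; exact DFunLike.congr_fun this v
  rw [e, exteriorPower.map_id]
  rfl

theorem contraction_isSmooth [FiniteDimensional ℝ E] {j l k : ℕ} (h : j + l = k)
    {X : MultivectorField E N j} {α : FormField E N k} (hX : X.IsSmoothOn Set.univ)
    (hα : α.IsSmooth) : (contraction h X α).IsSmooth := by
  intro p
  refine (contDiffOn_contract h (fun ℓ => ?_) (hα p)).congr fun y hy =>
    contraction_inChart h X α hy
  simpa using hX p ℓ

end LocalExpressions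

/-! ### Kernel fields, and pullback of conserved quantities by symmetries. -/

section Kernels

open Filter Topology

variable {E : Type*} [NormedAddCommGroup E] [NormedSpace ℝ E]
  {N : Type*} [TopologicalSpace N] [ChartedSpace E N]

/-- The product of a multivector field with a function. -/
def smulField {j : ℕ} (f : N → ℝ) (X : MultivectorField E N j) : MultivectorField E N j :=
  fun p => f p • X p

/-- The sum of two multivector fields. -/
def addField {j : ℕ} (X Y : MultivectorField E N j) : MultivectorField E N j := fun p => X p + Y p

theorem smulField_val {j : ℕ} (f : N → ℝ) (X : MultivectorField E N j) (p : N) :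
    (smulField f X).val p = f p • X.val p := rfl

theorem addField_val {j : ℕ} (X Y : MultivectorField E N j) (p : N) :
    (addField X Y).val p = X.val p + Y.val p := rfl

theorem smulField_inChart {j : ℕ} (f : N → ℝ) (X : MultivectorField E N j) (p : N) (y : E) :
    (smulField f X).inChart p y = f ((extChartAt 𝓘(ℝ, E) p).symm y) • X.inChart p y := by
  rw [MultivectorField.inChart_eq, MultivectorField.inChart_eq, smulField_val, map_smul]

theorem addField_inChart {j : ℕ} (X Y : MultivectorField E N j) (p : N) (y : E) :
    (addField X Y).inChart p y = X.inChart p y + Y.inChart p y := by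
  simp only [MultivectorField.inChart_eq, addField_val, map_add]

theorem mem_kerOn_iff {m : ℕ} {Ω : FormField E N (m + 1)} {U : Set N}
    {X : MultivectorField E N m} :
    X ∈ kerOn Ω U ↔ X.IsSmoothOn U ∧ ∀ p ∈ U, contract rfl (X.val p) (Ω.val p) = 0 := Iff.rfl

theorem addField_mem_kerOn {m : ℕ} {Ω : FormField E N (m + 1)} {U : Set N}
    {X Y : MultivectorField E N m} (hX : X ∈ kerOn Ω U) (hY : Y ∈ kerOn Ω U) :
    addField X Y ∈ kerOn Ω U := by
  rw [mem_kerOn_iff] at *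
  refine ⟨fun p ℓ => ?_, fun p hp => ?_⟩
  · simp only [addField_inChart, map_add]
    exact (hX.1 p ℓ).add (hY.1 p ℓ)
  · rw [addField_val, contract_add_left, hX.2 p hp, hY.2 p hp, add_zero]

/-- The value of a `0`-form. -/
def FormField.value (α : FormField E N 0) (x : N) : ℝ := α.val x Fin.elim0

theorem FormField.value_eq_zero_iff (α : FormField E N 0) (x : N) : α.value x = 0 ↔ α.val x = 0 := by
  refine ⟨fun h => ?_, fun h => by rw [FormField.value, h]; rfl⟩
  ext v
  rw [Subsingleton.elim v Fin.elim0]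
  exact h

theorem FormField.IsSmooth.continuous_value {α : FormField E N 0} (hα : α.IsSmooth) :
    Continuous α.value := by
  rw [continuous_iff_continuousAt]
  intro p
  have hp := mem_extChartAt_source (I := 𝓘(ℝ, E)) p
  have h1 : ContinuousAt (fun y => α.inChart p y Fin.elim0) (extChartAt 𝓘(ℝ, E) p p) :=
    (ContinuousAlternatingMap.apply ℝ E ℝ (Fin.elim0 : Fin 0 → E)).continuous.continuousAt.comp
      (hα.contDiffAt (mem_extChartAt_target p)).continuousAt
  have h2 := ContinuousAt.comp (f := extChartAt 𝓘(ℝ, E) p) h1 (continuousAt_extChartAt p)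
  refine h2.congr ?_
  filter_upwards [(isOpen_extChartAt_source p).mem_nhds hp] with x hx
  simp only [Function.comp_apply, FormField.inChart_eq, FormField.value,
    (extChartAt 𝓘(ℝ, E) p).left_inv hx, ContinuousAlternatingMap.compContinuousLinearMap_apply]
  congr 1
  exact Subsingleton.elim _ _

/-- Contracting an `(m-1)`-form with an `m`-vector gives zero, so only the term in `dξ` survives, up
to a sign. -/
theorem isConservedQuantity_iff {m : ℕ} (hm : 1 ≤ m) (Ω : FormField E N (m + 1))
    (vol : FormField E N m) (ξ : FormField E N (m - 1)) :
    IsConservedQuantity hm Ω vol ξ ↔ ξ.IsSmooth ∧ ∀ X ∈ kerTransverse Ω vol, ∀ p,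
      contract (l := 0) (by omega) (X.val p) (ξ.d.val p) = 0 := by
  refine and_congr Iff.rfl (forall₂_congr fun X _ => ?_)
  have e : lieDeriv (l := 0) (by omega) X ξ =
      -((-1 : ℝ) ^ m • contraction (l := 0) (by omega) X ξ.d) := rfl
  rw [e, neg_eq_zero, smul_eq_zero_iff_right (by simp), funext_iff]
  rfl

theorem isPushforwardOn_iff {j : ℕ} {f : N → N} {U : Set N} {X X' : MultivectorField E N j} :
    IsPushforwardOn f U X X' ↔ ∀ p ∈ U, X'.val (f p) =
      exteriorPower.map j (tangentD E E f p).toLinearMap (X.val p) := by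
  have key (p : N) : exteriorPower.map j (mfderiv 𝓘(ℝ, E) 𝓘(ℝ, E) f p).toLinearMap (X p) =
      exteriorPower.map j (tangentD E E f p).toLinearMap (X.val p) := by
    unfold MultivectorField.val tangentD
    rfl
  exact ⟨fun h p hp => (h p hp).trans (key p), fun h p hp => (h p hp).trans (key p).symm⟩

/-- A pointwise construction with a set-theoretic inverse suffices: smoothness on `f '' U` is part
of the conclusion of `PreservesKer`, and values elsewhere do not matter. -/
theorem exists_isPushforwardOn {j : ℕ} {f : N → N} {U : Set N} (hf : Set.InjOn f U)
    (X : MultivectorField E N j) : ∃ X' : MultivectorField E N j, IsPushforwardOn f U X X' := by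
  rcases isEmpty_or_nonempty N with hN | hN
  · exact ⟨X, fun p => (hN.false p).elim⟩
  let X' : N → ⋀[ℝ]^j E := fun q => exteriorPower.map j
    (tangentD E E f (Function.invFunOn f U q)).toLinearMap (X.val (Function.invFunOn f U q))
  have key : ∀ p ∈ U, X' (f p) =
      exteriorPower.map j (tangentD E E f p).toLinearMap (X.val p) := fun p hp => by
    simp only [X', hf.leftInvOn_invFunOn hp]
  exact ⟨X', isPushforwardOn_iff.2 key⟩

variable [IsManifold 𝓘(ℝ, E) ∞ N]

/-- The kernel condition is linear over functions, so a cutoff extends a local kernel field by zero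
to all of `N`. -/
theorem smulField_mem_kerOn_univ {m : ℕ} {Ω : FormField E N (m + 1)} {W : Set N}
    {X : MultivectorField E N m} (hX : X ∈ kerOn Ω W) {f : N → ℝ}
    (hf : ContMDiff 𝓘(ℝ, E) 𝓘(ℝ, ℝ) ∞ f) (hfW : tsupport f ⊆ interior W) :
    smulField f X ∈ kerOn Ω Set.univ := by
  rw [mem_kerOn_iff] at *
  refine ⟨fun p ℓ y hy => ContDiffAt.contDiffWithinAt ?_, fun x _ => ?_⟩
  · have hy := hy.1
    simp only [smulField_inChart, map_smul]
    have hc : ContinuousAt (extChartAt 𝓘(ℝ, E) p).symm y := continuousAt_extChartAt_symm'' hy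
    by_cases hs : (extChartAt 𝓘(ℝ, E) p).symm y ∈ tsupport f
    · have h1 : ContMDiffAt 𝓘(ℝ, E) 𝓘(ℝ, E) ∞ (extChartAt 𝓘(ℝ, E) p).symm y :=
        (contMDiffOn_extChartAt_symm p).contMDiffAt ((isOpen_extChartAt_target p).mem_nhds hy)
      have h2 : ContDiffAt ℝ ∞ (fun z => f ((extChartAt 𝓘(ℝ, E) p).symm z)) y :=
        (hf.contMDiffAt.comp y h1).contDiffAt
      refine h2.smul ((hX.1 p ℓ).contDiffAt ?_)
      exact inter_mem ((isOpen_extChartAt_target p).mem_nhds hy)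
        (hc.preimage_mem_nhds (mem_interior_iff_mem_nhds.1 (hfW hs)))
    · refine contDiffAt_const (c := (0 : ℝ)) |>.congr_of_eventuallyEq ?_
      filter_upwards [hc.preimage_mem_nhds ((isClosed_tsupport f).isOpen_compl.mem_nhds hs)] with z hz
      rw [image_eq_zero_of_notMem_tsupport hz, zero_smul]
  · rw [smulField_val, contract_smul_left]
    by_cases hx : x ∈ tsupport f
    · rw [hX.2 x (interior_subset (hfW hx)), smul_zero]
    · rw [image_eq_zero_of_notMem_tsupport hx, zero_smul]

variable [FiniteDimensional ℝ E]

theorem exists_bump [T2Space N] {p : N} {W : Set N} (hW : W ∈ 𝓝 p) :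
    ∃ f : N → ℝ, ContMDiff 𝓘(ℝ, E) 𝓘(ℝ, ℝ) ∞ f ∧ tsupport f ⊆ W ∧ f p = 1 ∧
      ∀ x, 0 ≤ f x ∧ f x ≤ 1 := by
  obtain ⟨f, -, hf⟩ := (SmoothBumpFunction.nhds_basis_tsupport (I := 𝓘(ℝ, E)) p).mem_iff.1 hW
  exact ⟨f, f.contMDiff, hf, f.eq_one, fun x => ⟨f.nonneg, f.le_one⟩⟩

/-- A form annihilated by all transverse fields in the kernel is annihilated by all local fields in
the kernel, as soon as there is a transverse one. -/
theorem contract_eq_zero_of_mem_kerOn [T2Space N] {m k : ℕ} (h : m + 0 = k)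
    {Ω : FormField E N (m + 1)} {vol : FormField E N m} (hvol : vol.IsSmooth) {β : FormField E N k}
    (hβ : ∀ X ∈ kerTransverse Ω vol, ∀ p, contract h (X.val p) (β.val p) = 0)
    {X₀ : MultivectorField E N m} (hX₀ : X₀ ∈ kerTransverse Ω vol) {p : N} {W : Set N}
    (hW : W ∈ 𝓝 p) {Z : MultivectorField E N m} (hZ : Z ∈ kerOn Ω W) :
    contract h (Z.val p) (β.val p) = 0 := by
  obtain ⟨f, hf, hfW, hfp, -⟩ := exists_bump (E := E) (interior_mem_nhds.2 hW)
  set Z' := smulField f Z with hZ'def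
  have hZ' : Z' ∈ kerOn Ω Set.univ := smulField_mem_kerOn_univ hZ hf hfW
  have hZp : Z'.val p = Z.val p := by rw [smulField_val, hfp, one_smul]
  rw [← hZp]
  set a := (contraction (l := 0) rfl X₀ vol).value with ha
  set b := (contraction (l := 0) rfl Z' vol).value with hb
  have ha_cont : Continuous a := (contraction_isSmooth rfl hX₀.1.1 hvol).continuous_value
  have hb_cont : Continuous b := (contraction_isSmooth rfl hZ'.1 hvol).continuous_value
  have ha0 : ∀ x, a x ≠ 0 := fun x hx => hX₀.2 x ((FormField.value_eq_zero_iff _ x).1 hx)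
  -- With `a = i(X₀)ω` and `b = i(Z')ω`, the bound `c |b| < |a|` holds near `p` by continuity. A
  -- bump `g` supported there keeps `a + c g b` nonzero everywhere.
  obtain ⟨c, hc0, hc⟩ : ∃ c : ℝ, 0 < c ∧ c * |b p| < |a p| := by
    refine ⟨|a p| / (|b p| + 1), by have := abs_pos.2 (ha0 p); positivity, ?_⟩
    have := abs_pos.2 (ha0 p)
    have hb1 : 0 ≤ |b p| := abs_nonneg _
    rw [div_mul_eq_mul_div, div_lt_iff₀ (by positivity)]
    nlinarith
  have hW' : {x | c * |b x| < |a x|} ∈ 𝓝 p :=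
    (isOpen_lt (continuous_const.mul hb_cont.abs) ha_cont.abs).mem_nhds hc
  obtain ⟨g, hg, hgW, hgp, hg01⟩ := exists_bump (E := E) hW'
  set X := addField X₀ (smulField (fun x => c * g x) Z') with hX
  have hcg : ContMDiff 𝓘(ℝ, E) 𝓘(ℝ, ℝ) ∞ (fun x => c * g x) := contMDiff_const.mul hg
  have hXker : X ∈ kerTransverse Ω vol := by
    refine ⟨addField_mem_kerOn hX₀.1 (smulField_mem_kerOn_univ hZ' hcg (by simp)), fun x hx => ?_⟩
    have e : (contraction (l := 0) rfl X vol).value x = a x + c * g x * b x := by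
      simp only [FormField.value, contraction_val, hX, addField_val, smulField_val,
        contract_add_left, contract_smul_left, ha, hb]
      rfl
    have h0 := (FormField.value_eq_zero_iff (contraction (l := 0) rfl X vol) x).2 hx
    rw [e] at h0
    by_cases hxg : x ∈ tsupport g
    · have h1 : c * |b x| < |a x| := hgW hxg
      have h2 : |a x| = c * g x * |b x| := by
        rw [eq_neg_of_add_eq_zero_left h0, abs_neg, abs_mul, abs_mul, abs_of_pos hc0,
          abs_of_nonneg (hg01 x).1]
      have h3 : c * g x * |b x| ≤ c * |b x| :=
        mul_le_mul_of_nonneg_right (mul_le_of_le_one_right hc0.le (hg01 x).2) (abs_nonneg _)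
      linarith
    · rw [image_eq_zero_of_notMem_tsupport hxg, mul_zero, zero_mul, add_zero] at h0
      exact ha0 x h0
  have h1 := hβ X hXker p
  rw [hX, addField_val, smulField_val, contract_add_left, contract_smul_left, hβ X₀ hX₀ p, zero_add,
    hgp, mul_one] at h1
  exact (smul_eq_zero.1 h1).resolve_left hc0.ne'

/-- A form annihilated by the kernel pulls back, under a map preserving the kernel, to a form
annihilated by the kernel. -/
theorem contract_pullback_eq_zero [T2Space N] {m k : ℕ} (h : m + 0 = k)
    {Ω : FormField E N (m + 1)} {vol : FormField E N m} (hvol : vol.IsSmooth) {β : FormField E N k}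
    (hβ : ∀ X ∈ kerTransverse Ω vol, ∀ p, contract h (X.val p) (β.val p) = 0)
    {f : N → N} {U : Set N} (hf : Set.InjOn f U) (hpres : PreservesKer Ω f U)
    {X : MultivectorField E N m} (hX : X ∈ kerTransverse Ω vol) {p : N} (hp : p ∈ U)
    (hU : f '' U ∈ 𝓝 (f p)) :
    contract h (X.val p) ((β.pullback f : FormField E N k).val p) = 0 := by
  obtain ⟨X', hX'⟩ := exists_isPushforwardOn hf X
  have hXU : X ∈ kerOn Ω U := ⟨fun q ℓ => (hX.1.1 q ℓ).mono (by simp), fun q _ => hX.1.2 q trivial⟩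
  -- The push-forward `X'` lies in the kernel over `f '' U` but may fail to be transverse; `X`
  -- itself is the transverse field needed to conclude.
  have h0 := contract_eq_zero_of_mem_kerOn h hvol hβ hX hU (hpres X X' hXU hX')
  rw [FormField.pullback_val, contract_compContinuousLinearMap, ← isPushforwardOn_iff.1 hX' p hp, h0]
  rfl

/-- The pullback of a conserved quantity under a symmetry is a conserved quantity. -/
theorem IsConservedQuantity.pullback [T2Space N] {m : ℕ} {hm : 1 ≤ m} {Ω : FormField E N (m + 1)}
    {vol : FormField E N m} (hvol : vol.IsSmooth) {ξ : FormField E N (m - 1)}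
    (hξ : IsConservedQuantity hm Ω vol ξ) {Φ : Diffeomorph 𝓘(ℝ, E) 𝓘(ℝ, E) N N ∞}
    (hΦ : IsSymmetry Ω Φ) : IsConservedQuantity hm Ω vol (ξ.pullback Φ) := by
  rw [isConservedQuantity_iff] at *
  refine ⟨hξ.1.pullback Φ.contMDiff, fun X hX p => ?_⟩
  rw [FormField.d_pullback hξ.1 Φ.contMDiff]
  refine contract_pullback_eq_zero _ hvol hξ.2 Φ.injective.injOn hΦ hX trivial ?_
  rw [Set.image_univ, Φ.surjective.range_eq]
  exact univ_mem

end Kernels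

/-! ### Cartan's formula for closed forms, and the derivative of a pullback along a flow. -/

section Cartan

open Filter Topology

variable {E : Type*} [NormedAddCommGroup E] [NormedSpace ℝ E]

/-- Moving a vector from the front to slot `i` costs the sign `(-1)^i`. -/
theorem removeNth_insert_eq_update {k : ℕ} (β : E [⋀^Fin (k + 1)]→L[ℝ] ℝ) (v : Fin (k + 1) → E)
    (i : Fin (k + 1)) (z : E) :
    (-1 : ℝ) ^ (i : ℕ) * β (Fin.cons z (i.removeNth v)) = β (Function.update v i z) := by
  have h1 := β.map_insertNth i z (i.removeNth v)
  rw [Fin.insertNth_removeNth] at h1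
  rw [h1]
  simp [Matrix.vecCons, zsmul_eq_mul]

theorem fderiv_apply_cons {k : ℕ} {β : E → E [⋀^Fin (k + 1)]→L[ℝ] ℝ} {V : E → E} {x : E}
    (hβ : DifferentiableAt ℝ β x) (hV : DifferentiableAt ℝ V x) (w : Fin k → E) (z : E) :
    fderiv ℝ (fun y => β y (Fin.cons (V y) w)) x z =
      fderiv ℝ β x z (Fin.cons (V x) w) + β x (Fin.cons (fderiv ℝ V x z) w) := by
  have hg : ∀ i : Fin (k + 1), DifferentiableAt ℝ
      (fun y => (Fin.cons (V y) w : Fin (k + 1) → E) i) x := fun i => by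
    refine Fin.cases ?_ (fun i => ?_) i
    · simpa using hV
    · simp
  have h := fderiv_continuousAlternatingMap_apply_apply hβ hg z
  refine h.trans ?_
  rw [Fin.sum_univ_succ]
  simp

/-- Cartan's formula for the Lie derivative of a closed form. -/
theorem extDeriv_contract_apply {k : ℕ} (h : 1 + k = k + 1) {β : E → E [⋀^Fin (k + 1)]→L[ℝ] ℝ}
    {V : E → E} {x : E} (hβ : DifferentiableAt ℝ β x) (hV : DifferentiableAt ℝ V x)
    (hi : DifferentiableAt ℝ
      (fun y => contract h (exteriorPower.ιMulti ℝ 1 (fun _ => V y)) (β y)) x)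
    (hclosed : extDeriv β x = 0) (v : Fin (k + 1) → E) :
    extDeriv (fun y => contract h (exteriorPower.ιMulti ℝ 1 (fun _ => V y)) (β y)) x v =
      fderiv ℝ β x (V x) v + ∑ i, β x (Function.update v i (fderiv ℝ V x (v i))) := by
  have h1 : ∀ i : Fin (k + 1), fderiv ℝ (fun y =>
      contract h (exteriorPower.ιMulti ℝ 1 (fun _ => V y)) (β y) (i.removeNth v)) x (v i) =
        fderiv ℝ β x (v i) (Fin.cons (V x) (i.removeNth v)) +
          β x (Fin.cons (fderiv ℝ V x (v i)) (i.removeNth v)) := by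
    intro i
    simp only [contract_ιMulti_one_apply]
    exact fderiv_apply_cons hβ hV _ _
  -- Closedness evaluated on `(V, v₀, …, v_k)` turns the alternating sum of the derivatives of `β`
  -- along the `v i` into its derivative along `V`.
  have h2 : extDeriv β x (Fin.cons (V x) v) = 0 := by rw [hclosed]; rfl
  refine (extDeriv_apply hi v).trans
    ((Finset.sum_congr rfl fun i _ => congrArg _ (h1 i)).trans ?_)
  rw [extDeriv, ContinuousAlternatingMap.alternatizeUncurryFin_apply, Fin.sum_univ_succ] at h2
  simp only [zsmul_eq_mul, Int.cast_pow, Int.cast_neg, Int.cast_one, mul_add,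
    Finset.sum_add_distrib]
  refine congrArg₂ (· + ·) ?_ (Finset.sum_congr rfl fun i _ => removeNth_insert_eq_update _ _ _ _)
  have h3 : ∀ i : Fin (k + 1), i.succ.removeNth (Fin.cons (V x) v : Fin (k + 2) → E) =
      Fin.cons (V x) (i.removeNth v) := by
    intro i
    ext j
    refine Fin.cases ?_ (fun j => ?_) j
    · simp [Fin.removeNth]
    · simp [Fin.removeNth]
  simp only [h3, Fin.cons_zero, Fin.cons_succ, Fin.val_succ, pow_succ, Fin.val_zero, pow_zero,
    one_smul, Fin.removeNth_zero, Fin.tail_cons, mul_neg, mul_one, neg_smul,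
    Finset.sum_neg_distrib] at h2
  simp only [zsmul_eq_mul, Int.cast_pow, Int.cast_neg, Int.cast_one] at h2
  linarith

/-- The derivative at time `0` of the pullback of a closed form by a flow. -/
theorem hasDerivWithinAt_pullback_flow [FiniteDimensional ℝ E] {k : ℕ} (h : 1 + k = k + 1)
    {β : E → E [⋀^Fin (k + 1)]→L[ℝ] ℝ} {V : E → E} {γ : ℝ → E} {A : ℝ → E →L[ℝ] E} {s : Set ℝ}
    (hβ : DifferentiableAt ℝ β (γ 0)) (hV : DifferentiableAt ℝ V (γ 0))
    (hi : DifferentiableAt ℝ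
      (fun y => contract h (exteriorPower.ιMulti ℝ 1 (fun _ => V y)) (β y)) (γ 0))
    (hclosed : extDeriv β (γ 0) = 0) (hγ : HasDerivWithinAt γ (V (γ 0)) s 0)
    (hA0 : A 0 = ContinuousLinearMap.id ℝ E) (hA : HasDerivWithinAt A (fderiv ℝ V (γ 0)) s 0) :
    HasDerivWithinAt (fun t => (β (γ t)).compContinuousLinearMap (A t))
      (extDeriv (fun y => contract h (exteriorPower.ιMulti ℝ 1 (fun _ => V y)) (β y)) (γ 0)) s 0 := by
  have h1 : HasDerivWithinAt (fun t => β (γ t)) (fderiv ℝ β (γ 0) (V (γ 0))) s 0 :=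
    hβ.hasFDerivAt.comp_hasDerivWithinAt 0 hγ
  have h2 := (h1.hasFDerivWithinAt.continuousAlternatingMapCompContinuousLinearMap
    hA.hasFDerivWithinAt).hasDerivWithinAt
  convert h2 using 1
  ext v
  rw [extDeriv_contract_apply h hβ hV hi hclosed]
  simp [hA0]
  refine Finset.sum_congr rfl fun i _ => ?_
  congr 1
  ext j
  rcases eq_or_ne j i with rfl | hj
  · simp
  · simp [hj]

end Cartan

/-! ### Vector fields and their Lie derivatives in charts. -/

section VectorFields

open Filter Topology

variable {E : Type*} [NormedAddCommGroup E] [NormedSpace ℝ E]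
  {N : Type*} [TopologicalSpace N] [ChartedSpace E N]

/-- The value of a vector field as a vector of the model space. -/
def vectorVal (Y : (p : N) → TangentSpace 𝓘(ℝ, E) p) (x : N) : E := Y x

/-- The local expression of a vector field in the chart at `p`. -/
def vectorInChart (Y : (p : N) → TangentSpace 𝓘(ℝ, E) p) (p : N) (y : E) : E :=
  chartD E p ((extChartAt 𝓘(ℝ, E) p).symm y) (vectorVal Y ((extChartAt 𝓘(ℝ, E) p).symm y))

theorem vectorToMultivector_val (Y : (p : N) → TangentSpace 𝓘(ℝ, E) p) (x : N) :
    (vectorToMultivector Y).val x = exteriorPower.ιMulti ℝ 1 (fun _ => vectorVal Y x) := by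
  unfold vectorToMultivector MultivectorField.val vectorVal
  rfl

theorem vectorToMultivector_inChart (Y : (p : N) → TangentSpace 𝓘(ℝ, E) p) (p : N) (y : E) :
    (vectorToMultivector Y).inChart p y =
      exteriorPower.ιMulti ℝ 1 (fun _ => vectorInChart Y p y) := by
  rw [MultivectorField.inChart_eq, vectorToMultivector_val, exteriorPower.map_apply_ιMulti]
  rfl

theorem FormField.IsSmooth.add {k : ℕ} {α β : FormField E N k} (hα : α.IsSmooth)
    (hβ : β.IsSmooth) : (α + β).IsSmooth := fun p => (hα p).add (hβ p)

/-- Functions, the case `m = 1`, have no term `d i(X) ξ` and fall under a separate clause of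
`lieDeriv`. -/
theorem lieDeriv_one_zero (h : 1 + 0 = 0 + 1) (X : MultivectorField E N 1) (ξ : FormField E N 0) :
    lieDeriv h X ξ = contraction h X ξ.d := by
  have key (c : E [⋀^Fin 0]→L[ℝ] ℝ) : -((-1 : ℝ) ^ 1 • c) = c := by
    ext v
    change -((-1 : ℝ) ^ 1 * c v) = c v
    ring
  exact FormField.ext_val fun x => key _

theorem lieDeriv_one_succ {k : ℕ} (h : 1 + (k + 1) = k + 1 + 1) (X : MultivectorField E N 1)
    (ξ : FormField E N (k + 1)) :
    lieDeriv h X ξ = (contraction (by omega : 1 + k = k + 1) X ξ).d + contraction h X ξ.d := by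
  have key (b c : E [⋀^Fin (k + 1)]→L[ℝ] ℝ) : b - (-1 : ℝ) ^ 1 • c = b + c := by
    ext v
    change b v - (-1 : ℝ) ^ 1 * c v = b v + c v
    ring
  exact FormField.ext_val fun x => key _ _

variable [IsManifold 𝓘(ℝ, E) ∞ N]

/-- The trivialization of the tangent bundle at `p` acts on fibres by the tangent map of the chart
at `p`. -/
theorem contDiffOn_vectorInChart {Y : (p : N) → TangentSpace 𝓘(ℝ, E) p}
    (hY : IsSmoothVectorField Y) (p : N) :
    ContDiffOn ℝ ∞ (vectorInChart Y p) (extChartAt 𝓘(ℝ, E) p).target := by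
  set e := trivializationAt E (TangentSpace 𝓘(ℝ, E) : N → Type _) p
  have h1 : ContMDiffOn 𝓘(ℝ, E) 𝓘(ℝ, E) ∞ (fun x => (e ⟨x, Y x⟩).2) e.baseSet :=
    e.contMDiffOn_section_baseSet_iff.1 hY.contMDiffOn
  have h2 := h1.comp (contMDiffOn_extChartAt_symm p) (fun y hy => by
    have := (extChartAt 𝓘(ℝ, E) p).map_target hy
    rw [extChartAt_source] at this
    exact this)
  refine h2.contDiffOn.congr fun y hy => ?_
  have hx := (extChartAt 𝓘(ℝ, E) p).map_target hy
  rw [extChartAt_source] at hx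
  have h3 := TangentBundle.continuousLinearMapAt_trivializationAt (I := 𝓘(ℝ, E)) hx
  have h4 := DFunLike.congr_fun h3 (Y ((extChartAt 𝓘(ℝ, E) p).symm y))
  refine h4.symm.trans ?_
  exact congrFun (e.coe_linearMapAt_of_mem (R := ℝ) hx) _

theorem vectorToMultivector_isSmoothOn [FiniteDimensional ℝ E]
    {Y : (p : N) → TangentSpace 𝓘(ℝ, E) p} (hY : IsSmoothVectorField Y) :
    (vectorToMultivector Y).IsSmoothOn Set.univ := by
  intro p ℓ
  rw [Set.preimage_univ, Set.inter_univ]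
  let L : E →ₗ[ℝ] ℝ := ℓ ∘ₗ (exteriorPower.oneEquiv ℝ E).symm.toLinearMap
  refine ((LinearMap.toContinuousLinearMap L).contDiff.comp_contDiffOn
    (contDiffOn_vectorInChart hY p)).congr fun y _ => ?_
  rw [vectorToMultivector_inChart]
  change _ = ℓ ((exteriorPower.oneEquiv ℝ E).symm _)
  congr 1

theorem lieDeriv_isSmooth [FiniteDimensional ℝ E] {Y : (p : N) → TangentSpace 𝓘(ℝ, E) p}
    (hY : IsSmoothVectorField Y) {l : ℕ} (h : 1 + l = l + 1) {ξ : FormField E N l}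
    (hξ : ξ.IsSmooth) : (lieDeriv h (vectorToMultivector Y) ξ).IsSmooth := by
  have h1 := contraction_isSmooth h (vectorToMultivector_isSmoothOn hY) hξ.d
  cases l with
  | zero => rw [lieDeriv_one_zero]; exact h1
  | succ k =>
    rw [lieDeriv_one_succ]
    exact (contraction_isSmooth _ (vectorToMultivector_isSmoothOn hY) hξ).d.add h1

/-- `d L(Y) ξ = d i(Y) d ξ` in charts. -/
theorem extDeriv_lieDeriv_inChart [FiniteDimensional ℝ E] {Y : (p : N) → TangentSpace 𝓘(ℝ, E) p}
    (hY : IsSmoothVectorField Y) {l : ℕ} (h : 1 + l = l + 1) {ξ : FormField E N l}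
    (hξ : ξ.IsSmooth) {p : N} {y : E} (hy : y ∈ (extChartAt 𝓘(ℝ, E) p).target) :
    extDeriv ((lieDeriv h (vectorToMultivector Y) ξ).inChart p) y =
      extDeriv ((contraction h (vectorToMultivector Y) ξ.d).inChart p) y := by
  have hs := vectorToMultivector_isSmoothOn hY
  cases l with
  | zero => rw [lieDeriv_one_zero]
  | succ k =>
    rw [lieDeriv_one_succ]
    have h1 := contraction_isSmooth h hs hξ.d
    have h2 := contraction_isSmooth (by omega : 1 + k = k + 1) hs hξ
    have e := extDeriv_fun_add ((h2.d.contDiffAt hy).differentiableAt (by simp))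
      ((h1.contDiffAt hy).differentiableAt (by simp))
    refine e.trans ?_
    -- The term `d d i(Y) ξ` vanishes.
    rw [FormField.extDeriv_d_inChart h2 hy, zero_add]

end VectorFields

/-! ### Local flows on the manifold, and Lie derivatives of conserved quantities. -/

section InfinitesimalSymmetries

open Filter Topology

variable {E : Type*} [NormedAddCommGroup E] [NormedSpace ℝ E]
  {N : Type*} [TopologicalSpace N] [ChartedSpace E N]

/-- A map of the model space, read in the chart at `p`. -/
def conjChart (p : N) (φ : E → E) (q : N) : N :=
  (extChartAt 𝓘(ℝ, E) p).symm (φ (extChartAt 𝓘(ℝ, E) p q))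

theorem mapInCharts_conjChart {p : N} {φ : E → E} {y : E}
    (hy : y ∈ (extChartAt 𝓘(ℝ, E) p).target) (hφ : φ y ∈ (extChartAt 𝓘(ℝ, E) p).target) :
    mapInCharts E E (conjChart p φ) p p y = φ y := by
  simp only [mapInCharts, conjChart, Function.comp_apply, (extChartAt 𝓘(ℝ, E) p).right_inv hy,
    (extChartAt 𝓘(ℝ, E) p).right_inv hφ]

theorem FormField.inChart_eq_zero_of_val_eq_zero {k : ℕ} {α : FormField E N k} {p : N}
    (h : α.val p = 0) : α.inChart p (extChartAt 𝓘(ℝ, E) p p) = 0 := by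
  have hp := mem_extChartAt_source (I := 𝓘(ℝ, E)) p
  rw [FormField.inChart_eq, (extChartAt 𝓘(ℝ, E) p).left_inv hp, h]
  rfl

variable [IsManifold 𝓘(ℝ, E) ∞ N]

/-- Integral curves in a chart give integral curves on the manifold. -/
theorem hasMFDerivAt_conjChart {Y : (p : N) → TangentSpace 𝓘(ℝ, E) p} {p : N} {γ : ℝ → E} {t : ℝ}
    (hγ : HasDerivAt γ (vectorInChart Y p (γ t)) t)
    (ht : γ t ∈ (extChartAt 𝓘(ℝ, E) p).target) :
    HasMFDerivAt 𝓘(ℝ, ℝ) 𝓘(ℝ, E) (fun s => (extChartAt 𝓘(ℝ, E) p).symm (γ s)) t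
      ((1 : ℝ →L[ℝ] ℝ).smulRight (Y ((extChartAt 𝓘(ℝ, E) p).symm (γ t)))) := by
  have h1 := (mdifferentiableAt_extChartAt_symm ht).hasMFDerivAt.comp t
    hγ.hasFDerivAt.hasMFDerivAt
  have e : (chartSymmD p (γ t)).comp
      (ContinuousLinearMap.toSpanSingleton ℝ (vectorInChart Y p (γ t))) =
      (1 : ℝ →L[ℝ] ℝ).smulRight (vectorVal Y ((extChartAt 𝓘(ℝ, E) p).symm (γ t))) := by
    ext
    have := DFunLike.congr_fun (chartSymmD_comp_chartD ht)
      (vectorVal Y ((extChartAt 𝓘(ℝ, E) p).symm (γ t)))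
    simpa [vectorInChart] using this
  exact e ▸ h1

theorem FormField.val_eq_zero_of_inChart_eq_zero {k : ℕ} {α : FormField E N k} {p : N}
    (h : α.inChart p (extChartAt 𝓘(ℝ, E) p p) = 0) : α.val p = 0 := by
  have hp := mem_extChartAt_source (I := 𝓘(ℝ, E)) p
  rw [FormField.inChart_eq, (extChartAt 𝓘(ℝ, E) p).left_inv hp] at h
  ext v
  have h1 := DFunLike.congr_fun h (fun i => chartD E p p (v i))
  have h2 := chartSymmD_comp_chartD' hp
  have h3 : (fun i => chartSymmD p (extChartAt 𝓘(ℝ, E) p p) (chartD E p p (v i))) = v := by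
    ext1 i
    exact DFunLike.congr_fun h2 (v i)
  rw [ContinuousAlternatingMap.compContinuousLinearMap_apply] at h1
  change α.val p (fun i => chartSymmD p (extChartAt 𝓘(ℝ, E) p p) (chartD E p p (v i))) = 0 at h1
  rwa [h3] at h1

/-- Local flows of smooth vector fields, constructed in a chart. -/
theorem exists_isLocalFlow [FiniteDimensional ℝ E] {Y : (p : N) → TangentSpace 𝓘(ℝ, E) p}
    (hY : IsSmoothVectorField Y) (p : N) :
    ∃ (φ : ℝ → E → E) (A : ℝ → E →L[ℝ] E) (U : Set N) (ε : ℝ), 0 < ε ∧ p ∈ U ∧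
      IsLocalFlow Y (fun t => conjChart p (φ t)) U ε ∧
      (∀ t ∈ Set.Ioo (-ε) ε, Set.InjOn (conjChart p (φ t)) U ∧
        conjChart p (φ t) '' U ∈ 𝓝 (conjChart p (φ t) p) ∧
        φ t (extChartAt 𝓘(ℝ, E) p p) ∈ (extChartAt 𝓘(ℝ, E) p).target) ∧
      φ 0 (extChartAt 𝓘(ℝ, E) p p) = extChartAt 𝓘(ℝ, E) p p ∧
      HasDerivAt (fun t => φ t (extChartAt 𝓘(ℝ, E) p p))
        (vectorInChart Y p (extChartAt 𝓘(ℝ, E) p p)) 0 ∧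
      (∀ t ∈ Set.Ico 0 ε, HasFDerivAt (φ t) (A t) (extChartAt 𝓘(ℝ, E) p p)) ∧
      A 0 = ContinuousLinearMap.id ℝ E ∧
      HasDerivWithinAt A (fderiv ℝ (vectorInChart Y p) (extChartAt 𝓘(ℝ, E) p p)) (Set.Ici 0) 0 := by
  have htarget : (extChartAt 𝓘(ℝ, E) p).target ∈ 𝓝 (extChartAt 𝓘(ℝ, E) p p) :=
    (isOpen_extChartAt_target p).mem_nhds (mem_extChartAt_target p)
  obtain ⟨φ, A, U, ε, hε, hU, hx₀U, hUt, hφ0, hφ, hφU, hφA, hA0, hA⟩ :=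
    exists_local_flow htarget (contDiffOn_vectorInChart hY p)
  have hz : (0 : ℝ) ∈ Set.Ioo (-ε) ε := ⟨by linarith, hε⟩
  have hd := (hφ _ hx₀U 0 hz).2
  rw [hφ0 _ hx₀U] at hd
  set c := extChartAt 𝓘(ℝ, E) p with hc
  -- The flow domain is transported from the chart; off the chart source `conjChart` carries no
  -- meaning.
  refine ⟨φ, A, c.source ∩ c ⁻¹' U, ε, hε, ⟨mem_extChartAt_source p, hx₀U⟩, ?_,
    fun t ht => ⟨?_, ?_, (hφ _ hx₀U t ht).1⟩, hφ0 _ hx₀U, hd, hφA, hA0, hA⟩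
  · refine ⟨(continuousOn_extChartAt p).isOpen_inter_preimage (isOpen_extChartAt_source p) hU,
      fun q hq => ?_, fun q hq t ht => ?_⟩
    · change c.symm (φ 0 (c q)) = q
      rw [hφ0 _ hq.2, c.left_inv hq.1]
    · exact (hasMFDerivAt_conjChart (hφ _ hq.2 t ht).2 (hφ _ hq.2 t ht).1).hasMFDerivWithinAt
  · intro q hq q' hq' heq
    have h1 : φ t (c q) = φ t (c q') :=
      c.symm.injOn (hφ _ hq.2 t ht).1 (hφ _ hq'.2 t ht).1 heq
    exact c.injOn hq.1 hq'.1 ((hφU t ht).1 hq.2 hq'.2 h1)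
  · have ht₀ := (hφ _ hx₀U t ht).1
    have h1 : conjChart p (φ t) p ∈ c.source := c.map_target ht₀
    have h2 : c (conjChart p (φ t) p) = φ t (c p) := c.right_inv ht₀
    have h3 : ContinuousAt c (conjChart p (φ t) p) :=
      (continuousOn_extChartAt p).continuousAt ((isOpen_extChartAt_source p).mem_nhds h1)
    have h4 : c ⁻¹' (φ t '' U) ∈ 𝓝 (conjChart p (φ t) p) :=
      h3.preimage_mem_nhds (h2 ▸ (hφU t ht).2)
    filter_upwards [h4, (isOpen_extChartAt_source p).mem_nhds h1] with q hq hqs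
    obtain ⟨y, hy, hyq⟩ := hq
    have hyt := hUt hy
    refine ⟨c.symm y, ⟨c.map_target hyt, ?_⟩, ?_⟩
    · change c (c.symm y) ∈ U
      rwa [c.right_inv hyt]
    · change c.symm (φ t (c (c.symm y))) = q
      rw [c.right_inv hyt, hyq, c.left_inv hqs]

/-- The pullback at `p` involves only the derivative of `φ` at the image of `p`, so
differentiability at this single point is enough. -/
theorem FormField.inChart_pullback_conjChart {k : ℕ} (β : FormField E N k) {p : N} {φ : E → E}
    {A : E →L[ℝ] E} (hA : HasFDerivAt φ A (extChartAt 𝓘(ℝ, E) p p))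
    (hφ : φ (extChartAt 𝓘(ℝ, E) p p) ∈ (extChartAt 𝓘(ℝ, E) p).target) :
    (β.pullback (conjChart p φ) : FormField E N k).inChart p (extChartAt 𝓘(ℝ, E) p p) =
      (β.inChart p (φ (extChartAt 𝓘(ℝ, E) p p))).compContinuousLinearMap A := by
  have hp := mem_extChartAt_source (I := 𝓘(ℝ, E)) p
  have hx₀ := mem_extChartAt_target (I := 𝓘(ℝ, E)) p
  have hcx₀ : (extChartAt 𝓘(ℝ, E) p).symm (extChartAt 𝓘(ℝ, E) p p) = p :=
    (extChartAt 𝓘(ℝ, E) p).left_inv hp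
  have hmd : MDifferentiableAt 𝓘(ℝ, E) 𝓘(ℝ, E) (conjChart p φ) p :=
    (mdifferentiableAt_extChartAt_symm hφ).comp p
      (hA.differentiableAt.mdifferentiableAt.comp p (mdifferentiableAt_extChartAt_of_mem hp))
  have hq : conjChart p φ ((extChartAt 𝓘(ℝ, E) p).symm (extChartAt 𝓘(ℝ, E) p p)) ∈
      (extChartAt 𝓘(ℝ, E) p).source := by
    rw [hcx₀]; exact (extChartAt 𝓘(ℝ, E) p).map_target hφ
  have h1 := β.inChart_pullback (f := conjChart p φ) (q := p) hx₀ (by rwa [hcx₀]) hq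
  have h2 : mapInCharts E E (conjChart p φ) p p =ᶠ[𝓝 (extChartAt 𝓘(ℝ, E) p p)] φ := by
    filter_upwards [(isOpen_extChartAt_target p).mem_nhds hx₀,
      hA.continuousAt.preimage_mem_nhds ((isOpen_extChartAt_target p).mem_nhds hφ)] with y hy hy'
    exact mapInCharts_conjChart hy hy'
  rwa [h2.fderiv_eq, h2.self_of_nhds, hA.fderiv] at h1

/-- The fixed multivector `X` acts linearly, so the contraction can be differentiated; one-sided
derivatives on `[0, ∞)` are unique. -/
theorem contract_deriv_eq_zero [FiniteDimensional ℝ E] {j k : ℕ} (h : j + 0 = k)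
    {X : ⋀[ℝ]^j E} {α : ℝ → E [⋀^Fin k]→L[ℝ] ℝ} {α' : E [⋀^Fin k]→L[ℝ] ℝ} {ε : ℝ} (hε : 0 < ε)
    (hα : HasDerivWithinAt α α' (Set.Ici 0) 0) (hX : ∀ t ∈ Set.Ico 0 ε, contract h X (α t) = 0) :
    contract h X α' = 0 := by
  have h1 := hasDerivWithinAt_contract h X hα
  have h2 := hasDerivWithinAt_const (0 : ℝ) (Set.Ici 0) (0 : E [⋀^Fin 0]→L[ℝ] ℝ)
  refine (uniqueDiffWithinAt_Ici (0 : ℝ)).eq_deriv _ h1 (h2.congr_of_eventuallyEq ?_ ?_)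
  · filter_upwards [Ico_mem_nhdsGE hε] with t ht using hX t ht
  · exact hX 0 ⟨le_rfl, hε⟩

/-- The derivative at time `0` of the pullback of the closed form `dξ` by the flow of `Y` is
`d L(Y) ξ`. -/
theorem hasDerivWithinAt_pullback_d [FiniteDimensional ℝ E]
    {Y : (p : N) → TangentSpace 𝓘(ℝ, E) p} (hY : IsSmoothVectorField Y) {l : ℕ}
    (h : 1 + l = l + 1) {ξ : FormField E N l} (hξ : ξ.IsSmooth) {p : N} {γ : ℝ → E}
    {A : ℝ → E →L[ℝ] E} {s : Set ℝ} (hγ0 : γ 0 = extChartAt 𝓘(ℝ, E) p p)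
    (hγ : HasDerivWithinAt γ (vectorInChart Y p (extChartAt 𝓘(ℝ, E) p p)) s 0)
    (hA0 : A 0 = ContinuousLinearMap.id ℝ E)
    (hA : HasDerivWithinAt A (fderiv ℝ (vectorInChart Y p) (extChartAt 𝓘(ℝ, E) p p)) s 0) :
    HasDerivWithinAt (fun t => (ξ.d.inChart p (γ t)).compContinuousLinearMap (A t))
      ((lieDeriv h (vectorToMultivector Y) ξ).d.inChart p (extChartAt 𝓘(ℝ, E) p p)) s 0 := by
  have hx₀ := mem_extChartAt_target (I := 𝓘(ℝ, E)) p
  have htarget := (isOpen_extChartAt_target (I := 𝓘(ℝ, E)) p).mem_nhds hx₀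
  have hs := contraction_isSmooth h (vectorToMultivector_isSmoothOn hY) hξ.d
  have hev : (fun y => contract h (exteriorPower.ιMulti ℝ 1 (fun _ => vectorInChart Y p y))
      (ξ.d.inChart p y)) =ᶠ[𝓝 (extChartAt 𝓘(ℝ, E) p p)]
        (contraction h (vectorToMultivector Y) ξ.d).inChart p := by
    filter_upwards [htarget] with y hy
    rw [contraction_inChart h _ _ hy, vectorToMultivector_inChart]
  have hder := hasDerivWithinAt_pullback_flow (s := s) h (β := ξ.d.inChart p)
    (V := vectorInChart Y p) (γ := γ) (A := A)
    (by rw [hγ0]; exact (hξ.d.contDiffAt hx₀).differentiableAt (by simp))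
    (by
      rw [hγ0]
      exact ((contDiffOn_vectorInChart hY p).contDiffAt htarget).differentiableAt (by simp))
    (by
      rw [hγ0]
      exact ((hs.contDiffAt hx₀).differentiableAt (by simp)).congr_of_eventuallyEq hev)
    (by rw [hγ0]; exact FormField.extDeriv_d_inChart hξ hx₀)
    (by rwa [hγ0]) hA0 (by rwa [hγ0])
  -- The derivative computed is `d i(Y) dξ`, which equals `d L(Y) ξ`.
  rw [hγ0, hev.extDeriv_eq, ← extDeriv_lieDeriv_inChart hY h hξ hx₀,
    ← FormField.d_inChart (lieDeriv_isSmooth hY h hξ) hx₀] at hder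
  exact hder

/-- The derivative of a conserved quantity along an infinitesimal symmetry is killed by the
transverse kernel. -/
theorem contraction_d_lieDeriv_eq_zero [FiniteDimensional ℝ E] [T2Space N] {m l : ℕ}
    (hmk : m + 0 = l + 1) {Ω : FormField E N (m + 1)} {vol : FormField E N m}
    (hvol : vol.IsSmooth) {ξ : FormField E N l} (hξs : ξ.IsSmooth)
    (hξ : ∀ X ∈ kerTransverse Ω vol, ∀ p, contract hmk (X.val p) (ξ.d.val p) = 0)
    {Y : (p : N) → TangentSpace 𝓘(ℝ, E) p} (hY : IsInfinitesimalSymmetry Ω Y)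
    (h : 1 + l = l + 1) {X : MultivectorField E N m} (hX : X ∈ kerTransverse Ω vol) (p : N) :
    (contraction hmk X (lieDeriv h (vectorToMultivector Y) ξ).d).val p = 0 := by
  obtain ⟨hYs, hY⟩ := hY
  have hx₀ := mem_extChartAt_target (I := 𝓘(ℝ, E)) p
  obtain ⟨φ, A, U, ε, hε, hpU, hflow, hF, hφ0, hφ, hφA, hA0, hA⟩ := exists_isLocalFlow hYs p
  -- Each `F_t` preserves the kernel, so `F_t^*dξ` at `p` is annihilated by the same multivector
  -- `X_p` for every small `t ≥ 0`; differentiating at `t = 0` finishes the proof.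
  have hzero : ∀ t ∈ Set.Ico 0 ε, contract hmk (X.inChart p (extChartAt 𝓘(ℝ, E) p p))
      ((ξ.d.inChart p (φ t (extChartAt 𝓘(ℝ, E) p p))).compContinuousLinearMap (A t)) = 0 := by
    intro t ht
    have htI : t ∈ Set.Ioo (-ε) ε := ⟨by linarith [ht.1], ht.2⟩
    obtain ⟨hinj, himage, ht₀⟩ := hF t htI
    have h0 := contract_pullback_eq_zero hmk hvol hξ hinj (hY _ U ε hflow t htI) hX hpU himage
    rw [← contraction_val] at h0
    have h1 := FormField.inChart_eq_zero_of_val_eq_zero h0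
    rw [contraction_inChart _ _ _ hx₀, ξ.d.inChart_pullback_conjChart (hφA t ht) ht₀] at h1
    exact h1
  have hder := hasDerivWithinAt_pullback_d hYs h hξs (s := Set.Ici 0) hφ0 hφ.hasDerivWithinAt
    hA0 hA
  have hfin := contract_deriv_eq_zero hmk hε hder hzero
  rw [← contraction_inChart _ _ _ hx₀] at hfin
  exact FormField.val_eq_zero_of_inChart_eq_zero hfin

/-- The Lie derivative of a conserved quantity along an infinitesimal symmetry is a conserved
quantity. -/
theorem isConservedQuantity_lieDeriv [FiniteDimensional ℝ E] [T2Space N] {m : ℕ} {hm : 1 ≤ m}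
    {Ω : FormField E N (m + 1)} {vol : FormField E N m} (hvol : vol.IsSmooth)
    {ξ : FormField E N (m - 1)} (hξ : IsConservedQuantity hm Ω vol ξ)
    {Y : (p : N) → TangentSpace 𝓘(ℝ, E) p} (hY : IsInfinitesimalSymmetry Ω Y)
    (h : 1 + (m - 1) = m - 1 + 1) :
    IsConservedQuantity hm Ω vol (lieDeriv h (vectorToMultivector Y) ξ) := by
  have hξ' := (isConservedQuantity_iff hm Ω vol ξ).1 hξ
  refine (isConservedQuantity_iff hm Ω vol _).2 ⟨lieDeriv_isSmooth hY.1 h hξ'.1, fun X hX p => ?_⟩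
  rw [← contraction_val]
  exact contraction_d_lieDeriv_eq_zero _ hvol hξ'.1 hξ'.2 hY h hX p

end InfinitesimalSymmetries

end Multisymplectic

end

open Multisymplectic in
theorem mainTheorem9 (m n : ℕ) (hm : 1 ≤ m)
    -- the base manifold `M`, of dimension `m`
    {B : Type*} [NormedAddCommGroup B] [NormedSpace ℝ B] [FiniteDimensional ℝ B]
    (hB : Module.finrank ℝ B = m)
    {M : Type*} [TopologicalSpace M] [ChartedSpace B M] [IsManifold 𝓘(ℝ, B) ∞ M]
    [T2Space M] [SecondCountableTopology M]
    -- the typical fibre `Q`, of dimension `n`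
    {F : Type*} [NormedAddCommGroup F] [NormedSpace ℝ F] [FiniteDimensional ℝ F]
    (hF : Module.finrank ℝ F = n)
    {Q : Type*} [TopologicalSpace Q] [ChartedSpace F Q] [IsManifold 𝓘(ℝ, F) ∞ Q]
    [T2Space Q] [SecondCountableTopology Q]
    -- the total space `N`, of dimension `n + m`
    {E : Type*} [NormedAddCommGroup E] [NormedSpace ℝ E] [FiniteDimensional ℝ E]
    (hE : Module.finrank ℝ E = n + m)
    {N : Type*} [TopologicalSpace N] [ChartedSpace E N] [IsManifold 𝓘(ℝ, E) ∞ N]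
    [T2Space N] [SecondCountableTopology N]
    -- the system `(N, Ω, ω)` with `ω = κ^*η`
    (κ : N → M) (η : FormField B M m) (Ω : FormField E N (m + 1))
    (hsys : IsPremultisymplecticSystem (F := F) Q κ η Ω) :
    (∀ (Φ : Diffeomorph 𝓘(ℝ, E) 𝓘(ℝ, E) N N ∞) (ξ : FormField E N (m - 1)),
      IsSymmetry Ω Φ → IsConservedQuantity hm Ω (η.pullback κ) ξ →
        IsConservedQuantity hm Ω (η.pullback κ) (ξ.pullback Φ)) ∧
    (∀ (Y : (p : N) → TangentSpace 𝓘(ℝ, E) p) (ξ : FormField E N (m - 1)),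
      IsInfinitesimalSymmetry Ω Y → IsConservedQuantity hm Ω (η.pullback κ) ξ →
        IsConservedQuantity hm Ω (η.pullback κ)
          (lieDeriv (Nat.add_comm 1 (m - 1)) (vectorToMultivector Y) ξ)) := by
  have hvol : (η.pullback κ).IsSmooth := hsys.volume_smooth.pullback hsys.bundle.contMDiff
  exact ⟨fun Φ ξ hΦ hξ => hξ.pullback hvol hΦ,
    fun Y ξ hY hξ => isConservedQuantity_lieDeriv hvol hξ hY _⟩
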